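/- Let $d\in\mathbb N$, $T\in(0,\infty]$, let $\mu_0$ be a Borel probability measure on $\mathbb R^d$ and let $K\in\mathbb R$ be such that the support of $\mu_0$ is contained in $\{x\in\mathbb R^d:\|x\|_2\le K\}$. Let $\sigma:[0,T)\to[0,\infty)$ satisfy hypothesis (H): $\sigma$ is strictly decreasing and differentiable on $[0,T)$ (one-sidedly at $0$), $\sigma'$ is bounded on $[0,t_0]$ for every $t_0\in(0,T)$, $\lim_{t\downarrow0}\sigma_t=1$ and $\lim_{t\uparrow T}\sigma_t=0$; put $\beta_t:=1-\sigma_t$. For $s>0$ let $\rho_s(x):=(2\pi s^2)^{-d/2}\mathrm e^{-\|x\|_2^2/(2s^2)}$, and for a probability measure $\nu$ on $\mathbb R^d$ with bounded support and $t\in[0,T)$ let $$\mathcal D^{\nu}_t(x):=\frac{\int_{\mathbb R^d} y\,\rho_{\sigma_t}(x-\beta_ty)\,\nu(\mathrm dy)}{\int_{\mathbb R^d}\rho_{\sigma_t}(x-\beta_ty)\,\nu(\mathrm dy)},\qquad b^{\nu}_t(x):=\frac{\sigma_t'}{\sigma_t}\bigl[x-\mathcal D^{\nu}_t(x)\bigr].$$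 Let $Y_0\sim N(0,\mathbb I_d)$ and, for each $N\ge1$, let $\eta_1,\dots,\eta_N$ be i.i.d. random variables with law $\mu_0$ that are independent of $Y_0$ (for different $N$ these data sets may be different), with empirical measure $\mu_0^N:=\frac1N\sum_{j=1}^N\delta_{\eta_j}$. Let $Y$ and $Y^N$ be almost surely solutions on $[0,T)$ of $$\frac{\mathrm dY_t}{\mathrm dt}=b^{\mu_0}_t(Y_t),\qquad \frac{\mathrm dY^N_t}{\mathrm dt}=b^{\mu_0^N}_t(Y^N_t),\qquad Y^N_0=Y_0,$$ with the given initial value $Y_0$. Then for every $t\in[0,T)$ the random variables $Y_t-Y^N_t$, $N\ge1$, are integrable and $$\sup_{N\ge1}\Bigl(\sqrt N\,\mathbb E\|Y_t-Y^N_t\|_2\Bigr)\le 2K\beta_t\,\mathrm e^{K^2\beta_t^2/(2\sigma_t^2)},$$ where the expectation is taken with respect to both the data $\eta_1,\dots,\eta_N$ and $Y_0$. In particular the bound does not depend on the dimension $d$. -/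

import Mathlib

open MeasureTheory ProbabilityTheory Filter Topology
open scoped ENNReal

namespace ProbFlow

noncomputable section

/-- The time interval `[0, T)`, where the terminal time `T` may be `∞`. -/
def timeInterval (T : EReal) : Set ℝ := {t : ℝ | 0 ≤ t ∧ (t : EReal) < T}

/-- The derivative `σ'_t` on `[0, T)`, which is one-sided at `t = 0`. -/
def sigmaDeriv (T : EReal) (σ : ℝ → ℝ) (t : ℝ) : ℝ := derivWithin σ (timeInterval T) t

/-- The function `β_t = 1 - σ_t`. -/
def beta (σ : ℝ → ℝ) (t : ℝ) : ℝ := 1 - σ t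

/-- The standing hypothesis on the terminal time `T ∈ (0, ∞]` and the schedule `σ : [0, T) → [0, ∞)`.
Values of `σ` outside `[0, T)` play no role. Continuity on `[0, T)` follows from differentiability,
and positivity on `[0, T)` from strict monotonicity and the limit at `T`. -/
structure HypH (T : EReal) (σ : ℝ → ℝ) : Prop where
  terminal_pos : 0 < T
  strictAnti : StrictAntiOn σ (timeInterval T)
  differentiable : DifferentiableOn ℝ σ (timeInterval T)
  deriv_bounded : ∀ t₀ ∈ timeInterval T, ∃ C : ℝ, ∀ t ∈ Set.Icc 0 t₀, |sigmaDeriv T σ t| ≤ C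
  tendsto_zero : Tendsto σ (𝓝[>] 0) (𝓝 1)
  /-- `σ_t → 0` as `t ↑ T`; the filter is `𝓝[<] T` if `T` is finite and `atTop` if `T = ∞`. -/
  tendsto_terminal : Tendsto σ (comap ((↑) : ℝ → EReal) (𝓝[<] T)) (𝓝 0)

variable {d : ℕ}

/-- The density `ρ_s(x) = (2πs²)^{-d/2} exp(-‖x‖² / (2s²))` of `N(0, s² I_d)`. -/
def rho (s : ℝ) (x : EuclideanSpace ℝ (Fin d)) : ℝ :=
  (2 * Real.pi * s ^ 2) ^ (-(d : ℝ) / 2) * Real.exp (-‖x‖ ^ 2 / (2 * s ^ 2))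

/-- `𝒟^ν_t(x) = ∫ y ρ_{σ_t}(x - β_t y) ν(dy) / ∫ ρ_{σ_t}(x - β_t y) ν(dy)`. -/
def denoiser (σ : ℝ → ℝ) (ν : Measure (EuclideanSpace ℝ (Fin d))) (t : ℝ)
    (x : EuclideanSpace ℝ (Fin d)) : EuclideanSpace ℝ (Fin d) :=
  (∫ y, rho (σ t) (x - beta σ t • y) ∂ν)⁻¹ • ∫ y, rho (σ t) (x - beta σ t • y) • y ∂ν

/-- The drift `b^ν_t(x) = (σ'_t / σ_t) (x - 𝒟^ν_t(x))`. -/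
def drift (T : EReal) (σ : ℝ → ℝ) (ν : Measure (EuclideanSpace ℝ (Fin d))) (t : ℝ)
    (x : EuclideanSpace ℝ (Fin d)) : EuclideanSpace ℝ (Fin d) :=
  (sigmaDeriv T σ t / σ t) • (x - denoiser σ ν t x)

/-- The path `y` solves `dy_t/dt = b^ν_t(y_t)` on `[0, T)` with `y_0 = x₀`. -/
def IsFlowSolution (T : EReal) (σ : ℝ → ℝ) (ν : Measure (EuclideanSpace ℝ (Fin d)))
    (x₀ : EuclideanSpace ℝ (Fin d)) (y : ℝ → EuclideanSpace ℝ (Fin d)) : Prop :=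
  y 0 = x₀ ∧
    ∀ t ∈ timeInterval T, HasDerivWithinAt y (drift T σ ν t (y t)) (timeInterval T) t

/-- The empirical measure `N⁻¹ ∑_j δ_{y_j}` of `N` points. -/
def empiricalMeasure {N : ℕ} (y : Fin N → EuclideanSpace ℝ (Fin d)) :
    Measure (EuclideanSpace ℝ (Fin d)) :=
  (N : ℝ≥0∞)⁻¹ • ∑ j, Measure.dirac (y j)

end

end ProbFlow

/-! Change the clock to `r = β_t / σ_t` and the space variable to `w = y / σ_t`. The linear part of
the drift cancels, and both equations become `dw/dr = D(r, w)`, where `D(r, x)` is the posterior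
mean of `V` given `Z + r V = x`, with `Z` standard Gaussian and `V` distributed as `μ₀` or as the
empirical measure. Three facts then give the bound.

Lipschitz bound: moving `x` tilts the posterior exponentially, so the increment of `D(r, ·)` is
controlled by a covariance. This gives the dimension-free Lipschitz constant `K² r`, for the
empirical measure as well (`norm_posteriorMean_sub_le`).

Marginal law: the flow driven by `μ₀` carries the standard Gaussian to the law of `Z + r V`,
independently of the data (`map_flow_prod_eq`). This is shown with the Euler scheme: one step `x + h
D(r, x)` and the exact transition `x + h V` have the same conditional mean, so on smooth test
functions they differ by `O(h²)`. Gaussian mollification supplies the smoothness.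

Statistical error: in the `L¹` distance of the two drifts under that marginal law, the density of
the law cancels the denominator of the posterior mean. What remains are errors of sample means of
`N` independent vectors, and their second moments give `(2K/√N) exp(K² r²/2)`
(`integral_norm_posteriorMean_sub_le`).

Grönwall's inequality with rate `K² r` has the integrating factor `exp(K² r²/2)`, which is also the
growth of the statistical error. The error at `R = β_t / σ_t` is therefore at most `R (2K/√N) exp(K²
R²/2)`, and multiplying by `σ_t` undoes the rescaling. -/

open scoped RealInnerProductSpace

namespace ProbFlow

/-! ### Exponentially tilted means and their sensitivity to the tilt. -/

section TiltedMean

variable {α F : Type*} [MeasurableSpace α] {ν : Measure α} [IsProbabilityMeasure ν]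
  [NormedAddCommGroup F] [NormedSpace ℝ F]

/-- The mean of `V` under the measure with density proportional to `exp f`. -/
noncomputable def expMean (ν : Measure α) (f : α → ℝ) (V : α → F) : F :=
  (∫ v, Real.exp (f v) ∂ν)⁻¹ • ∫ v, Real.exp (f v) • V v ∂ν

theorem integrable_exp_smul {f : α → ℝ} {V : α → F} {A K : ℝ} (hf : Measurable f)
    (hV : AEStronglyMeasurable V ν) (hfA : ∀ᵐ v ∂ν, |f v| ≤ A) (hVK : ∀ᵐ v ∂ν, ‖V v‖ ≤ K) :
    Integrable (fun v => Real.exp (f v) • V v) ν := by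
  refine Integrable.of_bound (C := Real.exp A * K) ?_ ?_
  · exact (hf.exp.aestronglyMeasurable).smul hV
  · filter_upwards [hfA, hVK] with v h1 h2
    rw [norm_smul, Real.norm_eq_abs, Real.abs_exp]
    gcongr
    exact (le_abs_self _).trans h1

theorem integrable_exp {f : α → ℝ} {A : ℝ} (hf : Measurable f) (hfA : ∀ᵐ v ∂ν, |f v| ≤ A) :
    Integrable (fun v => Real.exp (f v)) ν := by
  refine Integrable.of_bound (C := Real.exp A) hf.exp.aestronglyMeasurable ?_
  filter_upwards [hfA] with v h1
  rw [Real.norm_eq_abs, Real.abs_exp]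
  gcongr
  exact (le_abs_self _).trans h1

theorem hasDerivAt_integral_exp_smul {f g : α → ℝ} {V : α → F} {A G K : ℝ} (hf : Measurable f)
    (hg : Measurable g) (hV : AEStronglyMeasurable V ν) (hfA : ∀ᵐ v ∂ν, |f v| ≤ A)
    (hgG : ∀ᵐ v ∂ν, |g v| ≤ G) (hVK : ∀ᵐ v ∂ν, ‖V v‖ ≤ K) (τ : ℝ) :
    HasDerivAt (fun τ => ∫ v, Real.exp (f v + τ * g v) • V v ∂ν)
      (∫ v, Real.exp (f v + τ * g v) • g v • V v ∂ν) τ := by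
  have hmeas : ∀ τ : ℝ, Measurable fun v => f v + τ * g v := fun τ => by fun_prop
  have hbd : ∀ τ : ℝ, ∀ᵐ v ∂ν, |f v + τ * g v| ≤ A + |τ| * G := fun τ => by
    filter_upwards [hfA, hgG] with v h1 h2
    refine (abs_add_le _ _).trans (add_le_add h1 ?_)
    rw [abs_mul]
    gcongr
  refine (hasDerivAt_integral_of_dominated_loc_of_deriv_le (μ := ν) (s := Metric.ball τ 1)
    (bound := fun _ => Real.exp (A + (|τ| + 1) * G) * (G * K)) (Metric.ball_mem_nhds τ one_pos)
    ?_ ?_ (F' := fun τ v => Real.exp (f v + τ * g v) • g v • V v) ?_ ?_ ?_ ?_).2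
  · exact Eventually.of_forall fun τ => (hmeas τ).exp.aestronglyMeasurable.smul hV
  · exact integrable_exp_smul (hmeas τ) hV (hbd τ) hVK
  · exact (hmeas τ).exp.aestronglyMeasurable.smul (hg.aestronglyMeasurable.smul hV)
  · filter_upwards [hfA, hgG, hVK] with v h1 h2 h3 x hx
    have hx' : |x| ≤ |τ| + 1 := by
      have := abs_sub_abs_le_abs_sub x τ
      rw [Metric.mem_ball, Real.dist_eq] at hx
      linarith
    rw [norm_smul, norm_smul, Real.norm_eq_abs, Real.norm_eq_abs, Real.abs_exp]
    have hG : 0 ≤ G := (abs_nonneg _).trans h2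
    have h4 : f v + x * g v ≤ A + (|τ| + 1) * G := by
      have : x * g v ≤ (|τ| + 1) * G := by
        calc x * g v ≤ |x * g v| := le_abs_self _
          _ = |x| * |g v| := abs_mul _ _
          _ ≤ _ := by gcongr
      linarith [(le_abs_self _).trans h1]
    gcongr
  · exact integrable_const _
  · filter_upwards with v x _
    have : HasDerivAt (fun x => Real.exp (f v + x * g v)) (Real.exp (f v + x * g v) * g v) x := by
      have h1 : HasDerivAt (fun x => f v + x * g v) (g v) x := by
        simpa using ((hasDerivAt_id x).mul_const (g v)).const_add (f v)
      exact h1.exp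
    have := this.smul_const (V v)
    rwa [mul_smul] at this

theorem integral_exp_pos {f : α → ℝ} {A : ℝ} (hf : Measurable f) (hfA : ∀ᵐ v ∂ν, |f v| ≤ A) :
    0 < ∫ v, Real.exp (f v) ∂ν :=
  MeasureTheory.integral_exp_pos (integrable_exp hf hfA)

theorem norm_expMean_le {f : α → ℝ} {V : α → F} {A K : ℝ} (hf : Measurable f)
    (hfA : ∀ᵐ v ∂ν, |f v| ≤ A) (hVK : ∀ᵐ v ∂ν, ‖V v‖ ≤ K) :
    ‖expMean ν f V‖ ≤ K := by
  have hpos := integral_exp_pos hf hfA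
  rw [expMean, norm_smul, norm_inv, Real.norm_eq_abs, abs_of_pos hpos, inv_mul_le_iff₀ hpos,
    ← integral_mul_const]
  refine norm_integral_le_of_norm_le ((integrable_exp hf hfA).mul_const _) ?_
  filter_upwards [hVK] with v h
  rw [norm_smul, Real.norm_eq_abs, Real.abs_exp]
  gcongr

/-- Under an exponentially tilted measure, the covariance of a function bounded by `G` and a vector
bounded by `K` is at most `K * G`. -/
theorem norm_expMean_covariance_le {f g : α → ℝ} {V : α → F} {A G K : ℝ} (hf : Measurable f)
    (hg : Measurable g) (hV : AEStronglyMeasurable V ν) (hfA : ∀ᵐ v ∂ν, |f v| ≤ A)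
    (hgG : ∀ᵐ v ∂ν, |g v| ≤ G) (hVK : ∀ᵐ v ∂ν, ‖V v‖ ≤ K) :
    ‖expMean ν f (fun v => g v • V v) - expMean ν f g • expMean ν f V‖ ≤ K * G := by
  have hpos := integral_exp_pos hf hfA
  set M := ∫ v, Real.exp (f v) ∂ν with hM
  set m := expMean ν f g with hm
  have hgm : ∫ v, Real.exp (f v) * g v ∂ν = M * m := by
    simp only [hm, expMean, smul_eq_mul, ← hM]
    field_simp
  have hgV : ∀ᵐ v ∂ν, ‖g v • V v‖ ≤ G * K := by
    filter_upwards [hgG, hVK] with v h1 h2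
    rw [norm_smul, Real.norm_eq_abs]
    have hG : 0 ≤ G := (abs_nonneg _).trans h1
    gcongr
  have hgA : AEStronglyMeasurable g ν := hg.aestronglyMeasurable
  have iV := integrable_exp_smul hf hV hfA hVK
  have igV : Integrable (fun v => Real.exp (f v) • g v • V v) ν :=
    integrable_exp_smul hf (hgA.smul hV) hfA hgV
  have ig := integrable_exp_smul hf hgA hfA hgG
  have i1 := integrable_exp hf hfA
  obtain ⟨v₀, hv₀⟩ := (hgG.and hVK).exists
  have hG0 : 0 ≤ G := (abs_nonneg _).trans hv₀.1
  have hK0 : 0 ≤ K := (norm_nonneg _).trans hv₀.2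
  have imV : Integrable (fun v => m • Real.exp (f v) • V v) ν := iV.smul m
  -- Only `g` is centered, and `V` is bounded by `K` as it stands. The first absolute moment of `g -
  -- m` is at most its standard deviation, hence at most `G`; this avoids the factor 2 of the crude
  -- bound `|g - m| ≤ 2 G`.
  have key : expMean ν f (fun v => g v • V v) - m • expMean ν f V
      = M⁻¹ • ∫ v, (Real.exp (f v) * (g v - m)) • V v ∂ν := by
    rw [expMean, expMean, smul_comm m, ← smul_sub, ← integral_smul,
      ← integral_sub igV imV]
    congr 2 with v
    rw [mul_smul, sub_smul, smul_sub, smul_comm m]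
  rw [key, norm_smul, norm_inv, Real.norm_eq_abs, abs_of_pos hpos, inv_mul_le_iff₀ hpos]
  have hsq : Integrable (fun v => Real.exp (f v) * (g v) ^ 2) ν := by
    refine integrable_exp_smul hf (V := fun v => g v ^ 2) (K := G ^ 2)
      (hg.pow_const 2).aestronglyMeasurable hfA ?_
    filter_upwards [hgG] with v h
    rw [norm_pow, Real.norm_eq_abs]
    gcongr
  have hexp : ∀ v, Real.exp (f v) * (g v - m) ^ 2
      = Real.exp (f v) * (g v) ^ 2 - 2 * m * (Real.exp (f v) * g v) + m ^ 2 * Real.exp (f v) :=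
    fun v => by ring
  simp only [smul_eq_mul] at ig
  have hsqm : Integrable (fun v => Real.exp (f v) * (g v - m) ^ 2) ν := by
    simp only [hexp]
    exact (hsq.sub (ig.const_mul _)).add (i1.const_mul _)
  have hvar : ∫ v, Real.exp (f v) * (g v - m) ^ 2 ∂ν ≤ M * G ^ 2 := by
    have h1 : ∫ v, Real.exp (f v) * (g v - m) ^ 2 ∂ν
        = ∫ v, Real.exp (f v) * (g v) ^ 2 ∂ν - M * m ^ 2 := by
      simp only [hexp]
      rw [integral_add (f := fun v => Real.exp (f v) * g v ^ 2 - 2 * m * (Real.exp (f v) * g v))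
          (hsq.sub (ig.const_mul _)) (i1.const_mul _),
        integral_sub hsq (ig.const_mul _), integral_const_mul, integral_const_mul, hgm]
      ring
    have h2 : ∫ v, Real.exp (f v) * (g v) ^ 2 ∂ν ≤ M * G ^ 2 := by
      rw [hM, ← integral_mul_const]
      refine integral_mono_ae hsq (i1.mul_const _) ?_
      filter_upwards [hgG] with v h
      have : g v ^ 2 ≤ G ^ 2 := sq_le_sq' (abs_le.1 h).1 (abs_le.1 h).2
      gcongr
    have : 0 ≤ M * m ^ 2 := by positivity
    linarith
  -- The inequality used below divides by `G`, so `G = 0` is treated apart.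
  rcases hG0.eq_or_lt with rfl | hGpos
  · have hg0 : ∀ᵐ v ∂ν, g v = 0 := by
      filter_upwards [hgG] with v h
      exact abs_nonpos_iff.1 h
    have hm0 : m = 0 := by
      have : ∫ v, Real.exp (f v) • g v ∂ν = 0 := by
        refine integral_eq_zero_of_ae ?_
        filter_upwards [hg0] with v h
        simp [h]
      rw [hm, expMean, this]
      simp
    rw [integral_eq_zero_of_ae]
    · simp
    · filter_upwards [hg0] with v h
      simp [h, hm0]
  have hint : Integrable (fun v => K / 2 * (G⁻¹ * (Real.exp (f v) * (g v - m) ^ 2)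
      + G * Real.exp (f v))) ν :=
    ((hsqm.const_mul _).add (i1.const_mul _)).const_mul _
  calc ‖∫ v, (Real.exp (f v) * (g v - m)) • V v ∂ν‖
      ≤ ∫ v, K / 2 * (G⁻¹ * (Real.exp (f v) * (g v - m) ^ 2) + G * Real.exp (f v)) ∂ν := by
        refine norm_integral_le_of_norm_le hint ?_
        filter_upwards [hVK] with v h
        -- Young's inequality with weight `G` takes the place of Cauchy–Schwarz. Since the variance
        -- is at most `G²`, nothing is lost in the constant.
        have h2 : |g v - m| ≤ (G⁻¹ * (g v - m) ^ 2 + G) / 2 := by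
          rw [← sq_abs, inv_mul_eq_div, div_add' _ _ _ hGpos.ne', div_div, le_div_iff₀ (by positivity)]
          nlinarith [sq_nonneg (|g v - m| - G)]
        rw [norm_smul, norm_mul, Real.norm_eq_abs, Real.norm_eq_abs, Real.abs_exp]
        calc Real.exp (f v) * |g v - m| * ‖V v‖
            ≤ Real.exp (f v) * ((G⁻¹ * (g v - m) ^ 2 + G) / 2) * K := by gcongr
          _ = _ := by ring
    _ = K / 2 * (G⁻¹ * ∫ v, Real.exp (f v) * (g v - m) ^ 2 ∂ν + G * M) := by
        rw [integral_const_mul, integral_add (hsqm.const_mul _) (i1.const_mul _),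
          integral_const_mul, integral_const_mul]
    _ ≤ K / 2 * (G⁻¹ * (M * G ^ 2) + G * M) := by gcongr
    _ = M * (K * G) := by field_simp; ring

/-- Interpolate by the tilts `f + τ g` with `τ ∈ [0, 1]`: the derivative in `τ` is the tilted
covariance of `g` and `V`, so the mean value inequality applies. -/
theorem norm_expMean_add_sub_le {f g : α → ℝ} {V : α → F} {A G K : ℝ} (hf : Measurable f)
    (hg : Measurable g) (hV : AEStronglyMeasurable V ν) (hfA : ∀ᵐ v ∂ν, |f v| ≤ A)
    (hgG : ∀ᵐ v ∂ν, |g v| ≤ G) (hVK : ∀ᵐ v ∂ν, ‖V v‖ ≤ K) :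
    ‖expMean ν (fun v => f v + g v) V - expMean ν f V‖ ≤ K * G := by
  have hmeas : ∀ τ : ℝ, Measurable fun v => f v + τ * g v := fun τ => by fun_prop
  have hbd : ∀ τ : ℝ, ∀ᵐ v ∂ν, |f v + τ * g v| ≤ A + |τ| * G := fun τ => by
    filter_upwards [hfA, hgG] with v h1 h2
    refine (abs_add_le _ _).trans (add_le_add h1 ?_)
    rw [abs_mul]
    gcongr
  have hderiv : ∀ τ : ℝ, HasDerivAt (fun τ => expMean ν (fun v => f v + τ * g v) V)
      (expMean ν (fun v => f v + τ * g v) (fun v => g v • V v)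
        - expMean ν (fun v => f v + τ * g v) g • expMean ν (fun v => f v + τ * g v) V) τ := by
    intro τ
    have hpos := integral_exp_pos (hmeas τ) (hbd τ)
    have hN := hasDerivAt_integral_exp_smul hf hg hV hfA hgG hVK τ
    have hD := hasDerivAt_integral_exp_smul (V := fun _ => (1 : ℝ)) (K := 1) hf hg
      aestronglyMeasurable_const hfA hgG (by simp) τ
    simp only [smul_eq_mul, mul_one] at hD
    refine ((hD.fun_inv hpos.ne').fun_smul hN).congr_deriv ?_
    simp only [expMean, smul_eq_mul]
    rw [sub_eq_add_neg, ← neg_smul, smul_smul]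
    congr 2
    field_simp
  have := norm_image_sub_le_of_norm_deriv_le_segment_01'
    (f := fun τ : ℝ => expMean ν (fun v => f v + τ * g v) V) (C := K * G)
    (fun τ _ => (hderiv τ).hasDerivWithinAt)
    (fun τ _ => norm_expMean_covariance_le (hmeas τ) hg hV (hbd τ) hgG hVK)
  simpa using this

end TiltedMean

end ProbFlow

namespace ProbFlow

/-! ### The standard Gaussian measure: exponential moments and the Cameron–Martin formula. -/

section Gaussian

set_option linter.unusedSectionVars false

variable {E : Type*} [NormedAddCommGroup E] [InnerProductSpace ℝ E] [FiniteDimensional ℝ E]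
  [MeasurableSpace E] [BorelSpace E]

/-- In an orthonormal basis the integral factors into one-dimensional complex moment generating
functions `exp (z² / 2)`. The real part `a` of the exponent is there so that the characteristic
function of a tilted Gaussian can be read off. -/
theorem integral_cexp_inner_stdGaussian (a t : E) :
    ∫ x, Complex.exp (⟪x, a⟫ + ⟪x, t⟫ * Complex.I) ∂(stdGaussian E)
      = Complex.exp ((‖a‖ ^ 2 - ‖t‖ ^ 2) / 2 + ⟪a, t⟫ * Complex.I) := by
  set b := stdOrthonormalBasis ℝ E
  have h1 : ∀ (x : Fin (Module.finrank ℝ E) → ℝ),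
      Complex.exp (⟪∑ i, x i • b i, a⟫ + ⟪∑ i, x i • b i, t⟫ * Complex.I)
        = ∏ i, Complex.exp (((⟪b i, a⟫ : ℝ) + (⟪b i, t⟫ : ℝ) * Complex.I) * (x i : ℂ)) := by
    intro x
    rw [← Complex.exp_sum]
    congr 1
    simp only [sum_inner, real_inner_smul_left, Complex.ofReal_sum, Complex.ofReal_mul,
      Finset.sum_mul, ← Finset.sum_add_distrib]
    refine Finset.sum_congr rfl fun i _ => ?_
    ring
  rw [stdGaussian, integral_map (Measurable.aemeasurable (by fun_prop))
    (Measurable.aestronglyMeasurable (by fun_prop))]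
  simp only [b] at h1
  simp_rw [h1]
  rw [integral_fintype_prod_eq_prod (μ := fun _ => gaussianReal 0 1)
    (f := fun i (x : ℝ) => Complex.exp (((⟪stdOrthonormalBasis ℝ E i, a⟫ : ℝ)
      + (⟪stdOrthonormalBasis ℝ E i, t⟫ : ℝ) * Complex.I) * (x : ℂ)))]
  have h2 : ∀ z : ℂ, ∫ x : ℝ, Complex.exp (z * x) ∂(gaussianReal 0 1)
      = Complex.exp (z ^ 2 / 2) := by
    intro z
    have := complexMGF_id_gaussianReal (μ := 0) (v := 1) z
    simpa [complexMGF] using this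
  simp_rw [h2]
  rw [← Complex.exp_sum]
  congr 1
  have e1 : ∀ u w : E, ((⟪u, w⟫ : ℝ) : ℂ)
      = ∑ i, ((⟪stdOrthonormalBasis ℝ E i, u⟫ : ℝ) : ℂ) * ((⟪stdOrthonormalBasis ℝ E i, w⟫ : ℝ) : ℂ) := by
    intro u w
    rw [← (stdOrthonormalBasis ℝ E).sum_inner_mul_inner u w]
    push_cast
    refine Finset.sum_congr rfl fun i _ => ?_
    rw [real_inner_comm]
  have e2 : ∀ u : E, ((‖u‖ : ℝ) : ℂ) ^ 2
      = ∑ i, ((⟪stdOrthonormalBasis ℝ E i, u⟫ : ℝ) : ℂ) ^ 2 := by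
    intro u
    rw [← Complex.ofReal_pow, ← real_inner_self_eq_norm_sq, e1]
    simp_rw [sq]
  rw [e1 a t, e2 a, e2 t, ← Finset.sum_sub_distrib, Finset.sum_div, Finset.sum_mul,
    ← Finset.sum_add_distrib]
  refine Finset.sum_congr rfl fun i _ => ?_
  linear_combination (norm := ring_nf) (⟪stdOrthonormalBasis ℝ E i, t⟫ : ℂ) ^ 2 / 2 * Complex.I_sq

/-- Fernique's theorem makes `exp (C ‖x‖²)` integrable for some `C > 0`, and completing the square
dominates `c ‖x‖`. -/
theorem integrable_exp_norm_stdGaussian (c : ℝ) :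
    Integrable (fun x => Real.exp (c * ‖x‖)) (stdGaussian E) := by
  obtain ⟨C, hC, hint⟩ := IsGaussian.exists_integrable_exp_sq (stdGaussian E)
  refine (hint.const_mul (Real.exp (c ^ 2 / (4 * C)))).mono'
    (Measurable.aestronglyMeasurable (by fun_prop)) (ae_of_all _ fun x => ?_)
  rw [Real.norm_eq_abs, Real.abs_exp, ← Real.exp_add]
  gcongr
  have : 0 ≤ (c / (2 * C) - ‖x‖) ^ 2 * C := by positivity
  have h2 : (c / (2 * C) - ‖x‖) ^ 2 * C = c ^ 2 / (4 * C) + C * ‖x‖ ^ 2 - c * ‖x‖ := by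
    field_simp
    ring
  linarith

theorem integrable_exp_inner_stdGaussian (a : E) :
    Integrable (fun x => Real.exp ⟪x, a⟫) (stdGaussian E) := by
  refine (integrable_exp_norm_stdGaussian ‖a‖).mono'
    (Measurable.aestronglyMeasurable (by fun_prop)) (ae_of_all _ fun x => ?_)
  rw [Real.norm_eq_abs, Real.abs_exp, mul_comm]
  gcongr
  exact real_inner_le_norm x a

/-- The Cameron–Martin density of the translate of a standard Gaussian by `a`. -/
noncomputable def shiftDensity (a x : E) : ℝ := Real.exp (⟪x, a⟫ - ‖a‖ ^ 2 / 2)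

theorem shiftDensity_eq (a x : E) :
    shiftDensity a x = Real.exp (-(‖a‖ ^ 2 / 2)) * Real.exp ⟪x, a⟫ := by
  rw [shiftDensity, ← Real.exp_add]
  congr 1
  ring

theorem shiftDensity_pos (a x : E) : 0 < shiftDensity a x := Real.exp_pos _

theorem measurable_shiftDensity_right (a : E) : Measurable (shiftDensity a) := by
  unfold shiftDensity
  fun_prop

theorem integrable_shiftDensity (a : E) : Integrable (shiftDensity a) (stdGaussian E) := by
  have := (integrable_exp_inner_stdGaussian a).const_mul (Real.exp (-(‖a‖ ^ 2 / 2)))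
  refine this.congr (ae_of_all _ fun x => (shiftDensity_eq a x).symm)

/-- The Cameron–Martin formula for the standard Gaussian. -/
theorem map_add_const_stdGaussian (a : E) :
    (stdGaussian E).map (· + a)
      = (stdGaussian E).withDensity (fun x => ENNReal.ofReal (shiftDensity a x)) := by
  have hm := measurable_shiftDensity_right a
  have : IsFiniteMeasure ((stdGaussian E).withDensity
      (fun x => ENNReal.ofReal (shiftDensity a x))) :=
    isFiniteMeasure_withDensity_ofReal (integrable_shiftDensity a).2
  have : IsProbabilityMeasure ((stdGaussian E).map (· + a)) :=
    Measure.isProbabilityMeasure_map (by fun_prop)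
  -- Both sides are finite measures, so equality of the characteristic functions suffices.
  refine Measure.ext_of_charFun ?_
  ext t
  rw [charFun_map_add_const, charFun_stdGaussian, charFun_apply,
    integral_withDensity_eq_integral_toReal_smul (by fun_prop) (by simp)]
  have h : ∀ x : E, (ENNReal.ofReal (shiftDensity a x)).toReal • Complex.exp (⟪x, t⟫ * Complex.I)
      = Complex.exp (-(‖a‖ ^ 2 / 2)) * Complex.exp (⟪x, a⟫ + ⟪x, t⟫ * Complex.I) := by
    intro x
    rw [ENNReal.toReal_ofReal (shiftDensity_pos a x).le, shiftDensity, Complex.real_smul,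
      Complex.ofReal_exp, ← Complex.exp_add, ← Complex.exp_add]
    congr 1
    push_cast
    ring
  simp_rw [h]
  rw [integral_const_mul, integral_cexp_inner_stdGaussian, ← Complex.exp_add, ← Complex.exp_add]
  congr 1
  ring

theorem integral_comp_add_stdGaussian {F : Type*} [NormedAddCommGroup F] [NormedSpace ℝ F]
    {f : E → F} (hf : StronglyMeasurable f) (a : E) :
    ∫ x, f (x + a) ∂(stdGaussian E) = ∫ x, shiftDensity a x • f x ∂(stdGaussian E) := by
  have hm := measurable_shiftDensity_right a
  rw [← integral_map (φ := (· + a)) (by fun_prop) hf.aestronglyMeasurable,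
    map_add_const_stdGaussian, integral_withDensity_eq_integral_toReal_smul (by fun_prop) (by simp)]
  simp [ENNReal.toReal_ofReal (shiftDensity_pos a _).le]

theorem integral_shiftDensity (a : E) : ∫ x, shiftDensity a x ∂(stdGaussian E) = 1 := by
  simpa using (integral_comp_add_stdGaussian (f := fun _ : E => (1 : ℝ))
    stronglyMeasurable_const a).symm

theorem integral_exp_inner_stdGaussian (a : E) :
    ∫ x, Real.exp ⟪x, a⟫ ∂(stdGaussian E) = Real.exp (‖a‖ ^ 2 / 2) := by
  have := integral_shiftDensity a
  simp_rw [shiftDensity_eq] at this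
  rw [integral_const_mul, Real.exp_neg, inv_mul_eq_one₀ (Real.exp_pos _).ne'] at this
  exact this.symm

/-- A first-order expansion in `a` with a Gaussian-integrable remainder. It comes from `|exp w - 1 -
w| ≤ w² exp |w|`, with the polynomial factors absorbed into the exponential. -/
theorem abs_shiftDensity_sub_le {a : E} (ha : ‖a‖ ≤ 1) (x : E) :
    |shiftDensity a x - 1 - ⟪x, a⟫| ≤ ‖a‖ ^ 2 * (2 * Real.exp (3 * (‖x‖ + 1))) := by
  have key : ∀ w : ℝ, |Real.exp w - 1 - w| ≤ w ^ 2 * Real.exp |w| := by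
    intro w
    have := Complex.norm_exp_sub_sum_le_norm_mul_exp w 2
    simp only [Finset.sum_range_succ, Finset.sum_range_zero] at this
    norm_num at this
    have h2 : ‖Complex.exp w - (1 + w)‖ = |Real.exp w - 1 - w| := by
      rw [← Real.norm_eq_abs, ← Complex.norm_real]
      congr 1
      push_cast
      ring
    rwa [h2] at this
  set w := ⟪x, a⟫ - ‖a‖ ^ 2 / 2 with hw
  have ha0 := norm_nonneg a
  have hx0 := norm_nonneg x
  have hin : |⟪x, a⟫| ≤ ‖x‖ * ‖a‖ := abs_real_inner_le_norm x a
  have hwb : |w| ≤ ‖a‖ * (‖x‖ + 1) := by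
    calc |w| ≤ |⟪x, a⟫| + |‖a‖ ^ 2 / 2| := abs_sub _ _
      _ ≤ ‖x‖ * ‖a‖ + ‖a‖ ^ 2 / 2 := by
        rw [abs_of_nonneg (by positivity : 0 ≤ ‖a‖ ^ 2 / 2)]
        gcongr
      _ ≤ _ := by nlinarith
  have hwb' : |w| ≤ ‖x‖ + 1 := hwb.trans (by nlinarith)
  have h1 : |shiftDensity a x - 1 - ⟪x, a⟫| ≤ w ^ 2 * Real.exp |w| + ‖a‖ ^ 2 / 2 := by
    have : shiftDensity a x - 1 - ⟪x, a⟫ = (Real.exp w - 1 - w) + (-(‖a‖ ^ 2 / 2)) := by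
      rw [shiftDensity, ← hw]
      ring
    rw [this]
    refine (abs_add_le _ _).trans (add_le_add (key w) ?_)
    rw [abs_neg, abs_of_nonneg (by positivity)]
  have h2 : w ^ 2 ≤ ‖a‖ ^ 2 * (‖x‖ + 1) ^ 2 := by
    rw [← sq_abs w, ← mul_pow]
    gcongr
  have h3 : (‖x‖ + 1) ^ 2 ≤ Real.exp (2 * (‖x‖ + 1)) := by
    have := Real.add_one_le_exp (‖x‖ + 1)
    calc (‖x‖ + 1) ^ 2 ≤ Real.exp (‖x‖ + 1) ^ 2 := by gcongr; linarith
      _ = _ := by rw [← Real.exp_nat_mul]; norm_num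
  calc _ ≤ w ^ 2 * Real.exp |w| + ‖a‖ ^ 2 / 2 := h1
    _ ≤ (‖a‖ ^ 2 * Real.exp (2 * (‖x‖ + 1))) * Real.exp (‖x‖ + 1) + ‖a‖ ^ 2 / 2 := by
      gcongr
      exact h2.trans (by gcongr)
    _ = ‖a‖ ^ 2 * (Real.exp (3 * (‖x‖ + 1)) + 1 / 2) := by
      rw [mul_assoc, ← Real.exp_add]
      ring_nf
    _ ≤ _ := by
      have : 1 ≤ Real.exp (3 * (‖x‖ + 1)) := Real.one_le_exp (by positivity)
      gcongr
      linarith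

end Gaussian

end ProbFlow

namespace ProbFlow

/-! ### The rescaled drift as a posterior mean, and its regularity in space and time. -/

section PosteriorMean

set_option linter.unusedSectionVars false

variable {E : Type*} [NormedAddCommGroup E] [InnerProductSpace ℝ E] [FiniteDimensional ℝ E]
  [MeasurableSpace E] [BorelSpace E] {ν : Measure E} [IsProbabilityMeasure ν] {K R : ℝ}

/-- The mean of `V` given `Z + r V = x`, where `Z` is standard Gaussian and `V` has law `ν`. -/
noncomputable def posteriorMean (ν : Measure E) (r : ℝ) (x : E) : E :=
  expMean ν (fun v => ⟪x, r • v⟫ - ‖r • v‖ ^ 2 / 2) (fun v => v)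

/-- The density at `x` of `Z + r V` with respect to the law of `Z`. -/
noncomputable def mixtureDensity (ν : Measure E) (r : ℝ) (x : E) : ℝ :=
  ∫ v, shiftDensity (r • v) x ∂ν

theorem posteriorMean_eq (ν : Measure E) (r : ℝ) (x : E) :
    posteriorMean ν r x
      = (mixtureDensity ν r x)⁻¹ • ∫ v, shiftDensity (r • v) x • v ∂ν := rfl

theorem measurable_exponent (r : ℝ) (x : E) :
    Measurable fun v : E => ⟪x, r • v⟫ - ‖r • v‖ ^ 2 / 2 := by
  fun_prop

theorem exists_abs_exponent_le (hν : ∀ᵐ v ∂ν, ‖v‖ ≤ K) (r : ℝ) (x : E) :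
    ∃ A, ∀ᵐ v ∂ν, |⟪x, r • v⟫ - ‖r • v‖ ^ 2 / 2| ≤ A := by
  refine ⟨‖x‖ * (|r| * K) + (|r| * K) ^ 2 / 2, ?_⟩
  filter_upwards [hν] with v hv
  have h1 : ‖r • v‖ ≤ |r| * K := by
    rw [norm_smul, Real.norm_eq_abs]
    gcongr
  refine (abs_sub _ _).trans ?_
  rw [abs_of_nonneg (by positivity : 0 ≤ ‖r • v‖ ^ 2 / 2)]
  gcongr
  exact (abs_real_inner_le_norm _ _).trans (by gcongr)

theorem nonneg_of_ae_norm_le (hν : ∀ᵐ v ∂ν, ‖v‖ ≤ K) : 0 ≤ K := by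
  obtain ⟨v, hv⟩ := hν.exists
  exact (norm_nonneg v).trans hv

theorem norm_posteriorMean_le (hν : ∀ᵐ v ∂ν, ‖v‖ ≤ K) (r : ℝ) (x : E) :
    ‖posteriorMean ν r x‖ ≤ K := by
  obtain ⟨A, hA⟩ := exists_abs_exponent_le hν r x
  exact norm_expMean_le (measurable_exponent r x) hA hν

/-- Replacing `y` by `x` adds `⟪x - y, r v⟫` to the exponent, which is at most `r K ‖x - y‖` in
absolute value; the tilt estimate contributes the other factor `K`. -/
theorem norm_posteriorMean_sub_le (hν : ∀ᵐ v ∂ν, ‖v‖ ≤ K) {r : ℝ} (hr : 0 ≤ r) (x y : E) :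
    ‖posteriorMean ν r x - posteriorMean ν r y‖ ≤ K ^ 2 * r * ‖x - y‖ := by
  obtain ⟨A, hA⟩ := exists_abs_exponent_le hν r y
  have h := norm_expMean_add_sub_le (ν := ν) (G := ‖x - y‖ * (r * K)) (V := fun v : E => v)
    (g := fun v => ⟪x - y, r • v⟫) (measurable_exponent r y) (by fun_prop)
    (by fun_prop) hA ?_ hν
  · have e : (fun v : E => ⟪y, r • v⟫ - ‖r • v‖ ^ 2 / 2 + ⟪x - y, r • v⟫)
        = fun v => ⟪x, r • v⟫ - ‖r • v‖ ^ 2 / 2 := by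
      ext v
      rw [inner_sub_left]
      ring
    rw [e] at h
    calc _ ≤ _ := h
      _ = _ := by ring
  · filter_upwards [hν] with v hv
    refine (abs_real_inner_le_norm _ _).trans ?_
    rw [norm_smul, Real.norm_eq_abs, abs_of_nonneg hr]
    gcongr

/-- The same tilt estimate, with the increment in `r` of the quadratic exponent factored as `(r -
s)` times a bounded function of `v`. -/
theorem norm_posteriorMean_time_sub_le (hν : ∀ᵐ v ∂ν, ‖v‖ ≤ K) {r s : ℝ} (hr : r ∈ Set.Icc 0 R)
    (hs : s ∈ Set.Icc 0 R) (x : E) :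
    ‖posteriorMean ν r x - posteriorMean ν s x‖ ≤ K ^ 2 * (‖x‖ + R * K) * |r - s| := by
  have hK := nonneg_of_ae_norm_le hν
  have hR0 : 0 ≤ R := hr.1.trans hr.2
  obtain ⟨A, hA⟩ := exists_abs_exponent_le hν s x
  have h := norm_expMean_add_sub_le (ν := ν) (G := (‖x‖ * K + R * K ^ 2) * |r - s|)
    (V := fun v : E => v)
    (g := fun v => (r - s) * (⟪x, v⟫ - (r + s) / 2 * ‖v‖ ^ 2)) (measurable_exponent s x)
    (by fun_prop) (by fun_prop) hA ?_ hν
  · have e : (fun v : E => ⟪x, s • v⟫ - ‖s • v‖ ^ 2 / 2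
          + (r - s) * (⟪x, v⟫ - (r + s) / 2 * ‖v‖ ^ 2))
        = fun v => ⟪x, r • v⟫ - ‖r • v‖ ^ 2 / 2 := by
      ext v
      simp only [norm_smul, mul_pow, Real.norm_eq_abs, sq_abs, real_inner_smul_right]
      ring
    rw [e] at h
    calc _ ≤ _ := h
      _ = _ := by ring
  · filter_upwards [hν] with v hv
    rw [abs_mul, mul_comm]
    gcongr
    refine (abs_sub _ _).trans ?_
    have h0 : 0 ≤ (r + s) / 2 := by linarith [hr.1, hs.1]
    have h1 : (r + s) / 2 ≤ R := by linarith [hr.2, hs.2]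
    rw [abs_mul, abs_of_nonneg h0, abs_of_nonneg (sq_nonneg ‖v‖)]
    gcongr
    exact (abs_real_inner_le_norm _ _).trans (by gcongr)

theorem continuous_posteriorMean (hν : ∀ᵐ v ∂ν, ‖v‖ ≤ K) {r : ℝ} (hr : 0 ≤ r) :
    Continuous (posteriorMean ν r) := by
  refine (LipschitzWith.of_dist_le_mul (K := (K ^ 2 * r).toNNReal) fun x y => ?_).continuous
  rw [dist_eq_norm, dist_eq_norm, Real.coe_toNNReal _ (by positivity)]
  exact norm_posteriorMean_sub_le hν hr x y

theorem integrable_shiftDensity_smul_apply (hν : ∀ᵐ v ∂ν, ‖v‖ ≤ K) (r : ℝ) (x : E) :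
    Integrable (fun v => shiftDensity (r • v) x) ν := by
  obtain ⟨A, hA⟩ := exists_abs_exponent_le hν r x
  exact integrable_exp (measurable_exponent r x) hA

theorem integrable_shiftDensity_smul_smul (hν : ∀ᵐ v ∂ν, ‖v‖ ≤ K) (r : ℝ) (x : E) :
    Integrable (fun v => shiftDensity (r • v) x • v) ν := by
  obtain ⟨A, hA⟩ := exists_abs_exponent_le hν r x
  exact integrable_exp_smul (measurable_exponent r x) (by fun_prop) hA hν

theorem mixtureDensity_pos (hν : ∀ᵐ v ∂ν, ‖v‖ ≤ K) (r : ℝ) (x : E) :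
    0 < mixtureDensity ν r x := by
  obtain ⟨A, hA⟩ := exists_abs_exponent_le hν r x
  exact integral_exp_pos (measurable_exponent r x) hA

/-- The posterior is centered at its mean. This identity removes the first-order term when an Euler
step is compared with the transition of the mixture laws. -/
theorem integral_shiftDensity_smul_sub_posteriorMean (hν : ∀ᵐ v ∂ν, ‖v‖ ≤ K) (r : ℝ) (x : E) :
    ∫ v, shiftDensity (r • v) x • (v - posteriorMean ν r x) ∂ν = 0 := by
  have h1 := integrable_shiftDensity_smul_apply hν r x
  simp_rw [smul_sub]
  rw [integral_sub (integrable_shiftDensity_smul_smul hν r x) (h1.smul_const _),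
    integral_smul_const, posteriorMean_eq]
  change _ - mixtureDensity ν r x • _ = _
  rw [smul_inv_smul₀ (mixtureDensity_pos hν r x).ne', sub_self]

end PosteriorMean

/-! ### Stability and convergence of the Euler scheme. -/

section Euler

variable {E : Type*} [NormedAddCommGroup E] [NormedSpace ℝ E] {D : ℝ → E → E} {R L : ℝ}

/-- `m` steps of size `h` of the Euler scheme for `y' = D(r, y)`, starting at time `k h` in `x`. -/
def eulerFlow (D : ℝ → E → E) (h : ℝ) : ℕ → ℕ → E → E
  | _, 0, x => x
  | k, m + 1, x => eulerFlow D h (k + 1) m (x + h • D (k * h) x)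

theorem norm_eulerStep_sub_le {h r : ℝ} (hh : 0 ≤ h)
    (hD : ∀ x y, ‖D r x - D r y‖ ≤ L * ‖x - y‖) (x y : E) :
    ‖(x + h • D r x) - (y + h • D r y)‖ ≤ (1 + h * L) * ‖x - y‖ := by
  calc ‖(x + h • D r x) - (y + h • D r y)‖ = ‖(x - y) + h • (D r x - D r y)‖ := by
        congr 1
        rw [smul_sub]
        abel
    _ ≤ ‖x - y‖ + h * (L * ‖x - y‖) := by
        refine (norm_add_le _ _).trans ?_
        rw [norm_smul, Real.norm_eq_abs, abs_of_nonneg hh]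
        gcongr
        exact hD x y
    _ = _ := by ring

theorem norm_eulerFlow_sub_le {h : ℝ} (hh : 0 ≤ h) (hL : 0 ≤ L)
    (hD : ∀ r ∈ Set.Icc 0 R, ∀ x y, ‖D r x - D r y‖ ≤ L * ‖x - y‖) (m : ℕ) :
    ∀ k : ℕ, (k + m : ℕ) * h ≤ R → ∀ x y,
      ‖eulerFlow D h k m x - eulerFlow D h k m y‖ ≤ (1 + h * L) ^ m * ‖x - y‖ := by
  induction m with
  | zero => intro k _ x y; simp [eulerFlow]
  | succ m ih =>
    intro k hk x y
    have hk1 : (k + 1 + m : ℕ) * h ≤ R := by rwa [add_right_comm, add_assoc]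
    have hr : (k * h) ∈ Set.Icc 0 R := by
      refine ⟨by positivity, le_trans ?_ hk⟩
      gcongr
      exact le_self_add
    rw [eulerFlow, eulerFlow, pow_succ, mul_assoc]
    refine (ih (k + 1) hk1 _ _).trans ?_
    gcongr
    exact norm_eulerStep_sub_le hh (hD _ hr) x y

/-- Each step adds a local error `c h²`, which the later steps amplify by at most `1 + h L` each. -/
theorem norm_sub_eulerFlow_le {h c : ℝ} (hh : 0 ≤ h) (hL : 0 ≤ L) (hc : 0 ≤ c)
    (hD : ∀ r ∈ Set.Icc 0 R, ∀ x y, ‖D r x - D r y‖ ≤ L * ‖x - y‖) {y : ℝ → E}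
    (hy : ∀ s ∈ Set.Icc 0 R, ∀ s' ∈ Set.Icc s R,
      ‖y s' - y s - (s' - s) • D s (y s)‖ ≤ c * (s' - s) ^ 2) (m : ℕ) :
    ∀ k : ℕ, (k + m : ℕ) * h ≤ R → ∀ x,
      ‖y ((k + m : ℕ) * h) - eulerFlow D h k m x‖
        ≤ (1 + h * L) ^ m * (‖y (k * h) - x‖ + m * (c * h ^ 2)) := by
  induction m with
  | zero => intro k _ x; simp [eulerFlow]
  | succ m ih =>
    intro k hk x
    have hk1 : (k + 1 + m : ℕ) * h ≤ R := by rwa [add_right_comm, add_assoc]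
    have hkh : ((k : ℝ) * h) ≤ (k + 1 : ℕ) * h := by push_cast; nlinarith
    have hk1h : ((k + 1 : ℕ) : ℝ) * h ≤ R :=
      (mul_le_mul_of_nonneg_right (Nat.cast_le.2 (Nat.le_add_right _ _)) hh).trans hk1
    have hr : (k * h) ∈ Set.Icc 0 R := ⟨by positivity, hkh.trans hk1h⟩
    have hone : 1 ≤ 1 + h * L := by nlinarith [mul_nonneg hh hL]
    have hstep := hy _ hr ((k + 1 : ℕ) * h) ⟨hkh, hk1h⟩
    have hdiff : ((k + 1 : ℕ) : ℝ) * h - k * h = h := by push_cast; ring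
    rw [hdiff] at hstep
    have h1 : ‖y ((k + 1 : ℕ) * h) - (x + h • D (k * h) x)‖
        ≤ (1 + h * L) * (‖y (k * h) - x‖ + c * h ^ 2) := by
      calc ‖y ((k + 1 : ℕ) * h) - (x + h • D (k * h) x)‖
          = ‖(y ((k + 1 : ℕ) * h) - y (k * h) - h • D (k * h) (y (k * h)))
            + ((y (k * h) + h • D (k * h) (y (k * h))) - (x + h • D (k * h) x))‖ := by
            congr 1
            abel
        _ ≤ c * h ^ 2 + (1 + h * L) * ‖y (k * h) - x‖ :=
            (norm_add_le _ _).trans (add_le_add hstep (norm_eulerStep_sub_le hh (hD _ hr) _ _))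
        _ ≤ _ := by nlinarith [mul_nonneg (mul_nonneg hh hL) (mul_nonneg hc (sq_nonneg h))]
    have h2 := ih (k + 1) hk1 (x + h • D (k * h) x)
    rw [eulerFlow, show k + (m + 1) = k + 1 + m by ring]
    refine h2.trans ?_
    rw [pow_succ (1 + h * L), mul_assoc, Nat.cast_succ m]
    gcongr
    nlinarith [mul_nonneg (mul_nonneg hh hL) (mul_nonneg (Nat.cast_nonneg (α := ℝ) m)
      (mul_nonneg hc (sq_nonneg h)))]

theorem one_add_div_mul_pow_le (hL : 0 ≤ L) (hR : 0 ≤ R) {n m : ℕ} (hmn : m ≤ n) :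
    (1 + R / n * L) ^ m ≤ Real.exp (R * L) := by
  rcases Nat.eq_zero_or_pos n with rfl | hn
  · obtain rfl : m = 0 := by omega
    simpa using Real.one_le_exp (mul_nonneg hR hL)
  have h0 : 0 ≤ R / n * L := by positivity
  calc (1 + R / n * L) ^ m ≤ Real.exp (R / n * L) ^ m := by
        gcongr
        linarith [Real.add_one_le_exp (R / n * L)]
    _ = Real.exp (m * (R / n * L)) := by rw [← Real.exp_nat_mul]
    _ ≤ Real.exp (n * (R / n * L)) := by gcongr
    _ = _ := by
        congr 1
        have : (n : ℝ) ≠ 0 := by positivity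
        field_simp

/-- The Euler scheme converges to every path that satisfies the equation up to quadratic
errors. -/
theorem tendsto_eulerFlow {c : ℝ} (hR : 0 ≤ R) (hL : 0 ≤ L) (hc : 0 ≤ c)
    (hD : ∀ r ∈ Set.Icc 0 R, ∀ x y, ‖D r x - D r y‖ ≤ L * ‖x - y‖) {y : ℝ → E}
    (hy : ∀ s ∈ Set.Icc 0 R, ∀ s' ∈ Set.Icc s R,
      ‖y s' - y s - (s' - s) • D s (y s)‖ ≤ c * (s' - s) ^ 2) :
    Tendsto (fun n : ℕ => eulerFlow D (R / n) 0 n (y 0)) atTop (𝓝 (y R)) := by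
  rw [tendsto_iff_norm_sub_tendsto_zero]
  refine squeeze_zero' (Eventually.of_forall fun _ => norm_nonneg _) (g := fun n : ℕ =>
    Real.exp (R * L) * (c * R ^ 2) * (n : ℝ)⁻¹) ?_ ?_
  · filter_upwards [eventually_gt_atTop 0] with n hn
    have hn' : (n : ℝ) ≠ 0 := by positivity
    have h := norm_sub_eulerFlow_le (h := R / n) (by positivity) hL hc hD hy n 0
      (by simp; field_simp; rfl) (y 0)
    simp only [zero_add, Nat.cast_zero, zero_mul, sub_self, norm_zero,
      mul_div_cancel₀ R hn'] at h
    rw [norm_sub_rev]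
    refine h.trans ?_
    calc (1 + R / n * L) ^ n * (n * (c * (R / n) ^ 2))
        ≤ Real.exp (R * L) * (n * (c * (R / n) ^ 2)) := by
          gcongr
          exact one_add_div_mul_pow_le hL hR le_rfl
      _ = _ := by field_simp
  · simpa using (tendsto_inv_atTop_nhds_zero_nat (𝕜 := ℝ)).const_mul
      (Real.exp (R * L) * (c * R ^ 2))

end Euler

end ProbFlow

namespace ProbFlow

/-! ### The laws of `Z + r V` and their densities with respect to the standard Gaussian. -/

section MixtureLaw

set_option linter.unusedSectionVars false

variable {E : Type*} [NormedAddCommGroup E] [InnerProductSpace ℝ E] [FiniteDimensional ℝ E]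
  [MeasurableSpace E] [BorelSpace E] {ν : Measure E} [IsProbabilityMeasure ν] {K R : ℝ}

/-- The law of `Z + r V`, where `Z` is standard Gaussian and `V` is independent with law `ν`. -/
noncomputable def mixtureLaw (ν : Measure E) (r : ℝ) : Measure E :=
  (ν.prod (stdGaussian E)).map (fun p => p.2 + r • p.1)

instance (r : ℝ) : IsProbabilityMeasure (mixtureLaw ν r) :=
  Measure.isProbabilityMeasure_map (by fun_prop)

theorem mixtureLaw_zero : mixtureLaw ν 0 = stdGaussian E := by
  simp [mixtureLaw, Measure.map_snd_prod]

theorem measurable_shiftDensity_smul (r : ℝ) :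
    Measurable fun p : E × E => shiftDensity (r • p.1) p.2 := by
  unfold shiftDensity
  fun_prop

theorem integrable_shiftDensity_prod (r : ℝ) :
    Integrable (fun p : E × E => shiftDensity (r • p.1) p.2) (ν.prod (stdGaussian E)) := by
  rw [integrable_prod_iff (measurable_shiftDensity_smul r).aestronglyMeasurable]
  refine ⟨ae_of_all _ fun v => integrable_shiftDensity (r • v), ?_⟩
  simp_rw [Real.norm_eq_abs, abs_of_pos (shiftDensity_pos _ _), integral_shiftDensity]
  exact integrable_const _

theorem integrable_shiftDensity_mul_prod (r : ℝ) {F : E → E → ℝ}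
    (hF : Measurable (Function.uncurry F)) {B : ℝ} (hB : ∀ x v, |F x v| ≤ B) :
    Integrable (fun p : E × E => shiftDensity (r • p.1) p.2 * F p.2 p.1)
      (ν.prod (stdGaussian E)) := by
  have hF' : Measurable fun p : E × E => F p.2 p.1 := hF.comp measurable_swap
  exact (integrable_shiftDensity_prod r).mul_bdd (c := B) hF'.aestronglyMeasurable
    (ae_of_all _ fun p => hB _ _)

/-- Cameron–Martin for each fixed `v`, then Fubini: the joint law of `(Z + r V, V)` is disintegrated
along its first coordinate. -/
theorem integral_prod_comp_add_smul (r : ℝ) {F : E → E → ℝ}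
    (hF : Measurable (Function.uncurry F)) {B : ℝ} (hB : ∀ x v, |F x v| ≤ B) :
    ∫ p, F (p.2 + r • p.1) p.1 ∂(ν.prod (stdGaussian E))
      = ∫ x, ∫ v, shiftDensity (r • v) x * F x v ∂ν ∂(stdGaussian E) := by
  have h1 : Measurable fun p : E × E => F (p.2 + r • p.1) p.1 :=
    hF.comp (by fun_prop : Measurable fun p : E × E => (p.2 + r • p.1, p.1))
  rw [integral_prod _ (Integrable.of_bound h1.aestronglyMeasurable B (ae_of_all _ fun p => hB _ _))]
  have h2 : ∀ v, ∫ z, F (z + r • v) v ∂(stdGaussian E)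
      = ∫ x, shiftDensity (r • v) x * F x v ∂(stdGaussian E) := fun v =>
    integral_comp_add_stdGaussian (f := fun x => F x v)
      (hF.comp (by fun_prop : Measurable fun x : E => (x, v))).stronglyMeasurable (r • v)
  simp_rw [h2]
  exact integral_integral_swap (integrable_shiftDensity_mul_prod r hF hB)

theorem integral_mixtureLaw (r : ℝ) {f : E → ℝ} (hf : Measurable f) :
    ∫ x, f x ∂(mixtureLaw ν r) = ∫ p, f (p.2 + r • p.1) ∂(ν.prod (stdGaussian E)) :=
  integral_map (by fun_prop) hf.aestronglyMeasurable

theorem integral_mixtureLaw_eq (r : ℝ) {f : E → ℝ} (hf : Measurable f) {B : ℝ}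
    (hB : ∀ x, |f x| ≤ B) :
    ∫ x, f x ∂(mixtureLaw ν r) = ∫ x, mixtureDensity ν r x * f x ∂(stdGaussian E) := by
  rw [integral_mixtureLaw r hf, integral_prod_comp_add_smul r (F := fun x _ => f x)
    (hf.comp measurable_fst) (fun x _ => hB x)]
  simp_rw [integral_mul_const]
  rfl

theorem integrable_mixtureDensity (r : ℝ) :
    Integrable (mixtureDensity ν r) (stdGaussian E) :=
  (integrable_shiftDensity_prod r).integral_prod_right

theorem integral_mixtureDensity (r : ℝ) :
    ∫ x, mixtureDensity ν r x ∂(stdGaussian E) = 1 := by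
  have := integral_mixtureLaw_eq (ν := ν) r (f := fun _ => 1) measurable_const (B := 1) (by simp)
  simpa using this.symm

end MixtureLaw

/-! ### Gaussian mollification of bounded Lipschitz functions. -/

section Smoothing

set_option linter.unusedSectionVars false

variable {E : Type*} [NormedAddCommGroup E] [InnerProductSpace ℝ E] [FiniteDimensional ℝ E]
  [MeasurableSpace E] [BorelSpace E] {ν : Measure E} [IsProbabilityMeasure ν] {K R : ℝ}
  {ψ : E → ℝ} {B Λ ε : ℝ}

/-- The convolution of `ψ` with a centered Gaussian of standard deviation `ε`. -/
noncomputable def gaussSmooth (ε : ℝ) (ψ : E → ℝ) (x : E) : ℝ :=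
  ∫ z, ψ (x + ε • z) ∂(stdGaussian E)

theorem continuous_of_abs_sub_le (hΛ : ∀ x y, |ψ x - ψ y| ≤ Λ * ‖x - y‖) : Continuous ψ := by
  refine (LipschitzWith.of_dist_le_mul (K := Λ.toNNReal) fun x y => ?_).continuous
  rw [dist_eq_norm, dist_eq_norm, Real.norm_eq_abs]
  refine (hΛ x y).trans ?_
  gcongr
  exact Real.le_coe_toNNReal Λ

theorem integrable_comp_add_smul (hψ : Continuous ψ) (hB : ∀ x, |ψ x| ≤ B) (x : E) :
    Integrable (fun z => ψ (x + ε • z)) (stdGaussian E) :=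
  Integrable.of_bound (Continuous.aestronglyMeasurable (by fun_prop)) B (ae_of_all _ fun _ => hB _)

theorem abs_gaussSmooth_le (hB : ∀ x, |ψ x| ≤ B) (x : E) : |gaussSmooth ε ψ x| ≤ B := by
  have := norm_integral_le_of_norm_le_const (μ := stdGaussian E) (f := fun z => ψ (x + ε • z))
    (ae_of_all _ fun z => hB _)
  simpa [gaussSmooth] using this

theorem abs_gaussSmooth_sub_le (hΛ : ∀ x y, |ψ x - ψ y| ≤ Λ * ‖x - y‖) (hB : ∀ x, |ψ x| ≤ B)
    (x y : E) : |gaussSmooth ε ψ x - gaussSmooth ε ψ y| ≤ Λ * ‖x - y‖ := by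
  have hψ := continuous_of_abs_sub_le hΛ
  rw [gaussSmooth, gaussSmooth, ← integral_sub (integrable_comp_add_smul hψ hB x)
    (integrable_comp_add_smul hψ hB y)]
  have := norm_integral_le_of_norm_le_const (μ := stdGaussian E) (C := Λ * ‖x - y‖)
    (f := fun z => ψ (x + ε • z) - ψ (y + ε • z)) (ae_of_all _ fun z => by
      refine (hΛ _ _).trans_eq ?_
      congr 2
      abel)
  simpa using this

theorem integrable_norm_stdGaussian : Integrable (fun z : E => ‖z‖) (stdGaussian E) :=
  (IsGaussian.integrable_id (μ := stdGaussian E)).norm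

theorem abs_gaussSmooth_sub_self_le (hΛ : ∀ x y, |ψ x - ψ y| ≤ Λ * ‖x - y‖)
    (hB : ∀ x, |ψ x| ≤ B) (hε : 0 ≤ ε) (x : E) :
    |gaussSmooth ε ψ x - ψ x| ≤ Λ * ε * ∫ z : E, ‖z‖ ∂(stdGaussian E) := by
  have hψ := continuous_of_abs_sub_le hΛ
  have h1 : gaussSmooth ε ψ x - ψ x = ∫ z, (ψ (x + ε • z) - ψ x) ∂(stdGaussian E) := by
    rw [integral_sub (integrable_comp_add_smul hψ hB x) (integrable_const _)]
    simp [gaussSmooth]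
  rw [h1, ← integral_const_mul, ← Real.norm_eq_abs]
  refine norm_integral_le_of_norm_le (f := fun z => ψ (x + ε • z) - ψ x)
    (integrable_norm_stdGaussian.const_mul _) (ae_of_all _ fun z => ?_)
  refine (hΛ _ _).trans_eq ?_
  rw [add_sub_cancel_left, norm_smul, Real.norm_eq_abs, abs_of_nonneg hε, mul_assoc]

/-- The smoothing constant in the second order expansion of `gaussSmooth`. -/
noncomputable def expansionConst (E : Type*) [NormedAddCommGroup E] [InnerProductSpace ℝ E]
    [FiniteDimensional ℝ E] [MeasurableSpace E] [BorelSpace E] : ℝ :=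
  ∫ z : E, 2 * Real.exp (3 * (‖z‖ + 1)) ∂(stdGaussian E)

theorem integrable_expansionConst :
    Integrable (fun z : E => 2 * Real.exp (3 * (‖z‖ + 1))) (stdGaussian E) := by
  have := ((integrable_exp_norm_stdGaussian (E := E) 3).const_mul (Real.exp 3)).const_mul 2
  refine this.congr (ae_of_all _ fun z => ?_)
  simp only
  rw [← Real.exp_add]
  ring_nf

theorem expansionConst_nonneg : 0 ≤ expansionConst E :=
  integral_nonneg fun z => by positivity

/-- By Cameron–Martin the displacement `a` can be moved from `ψ` onto the Gaussian density, so the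
expansion needs no differentiability of `ψ`. Measured in units of `ε`, the displacement has norm at
most 1, and the remainder carries `ε⁻²`. -/
theorem exists_gaussSmooth_expansion (hψ : Continuous ψ) (hB : ∀ x, |ψ x| ≤ B) (hε : 0 < ε)
    (x : E) : ∃ l : E, ∀ a : E, ‖a‖ ≤ ε →
      |gaussSmooth ε ψ (x + a) - gaussSmooth ε ψ x - ⟪l, a⟫|
        ≤ B * expansionConst E / ε ^ 2 * ‖a‖ ^ 2 := by
  have hB0 : 0 ≤ B := (abs_nonneg _).trans (hB 0)
  have hint : Integrable (fun z => ψ (x + ε • z) • z) (stdGaussian E) := by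
    refine (IsGaussian.integrable_id (μ := stdGaussian E)).bdd_smul B
      (Continuous.aestronglyMeasurable (by fun_prop)) (ae_of_all _ fun z => hB _)
  -- The gradient of the mollified function, written by Gaussian integration by parts.
  refine ⟨ε⁻¹ • ∫ z, ψ (x + ε • z) • z ∂(stdGaussian E), fun a ha => ?_⟩
  set b := ε⁻¹ • a with hb
  have hab : a = ε • b := by rw [hb, smul_inv_smul₀ hε.ne']
  have hb1 : ‖b‖ ≤ 1 := by
    rw [hb, norm_smul, norm_inv, Real.norm_eq_abs, abs_of_pos hε, inv_mul_le_iff₀ hε]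
    simpa using ha
  have h1 : gaussSmooth ε ψ (x + a)
      = ∫ z, shiftDensity b z * ψ (x + ε • z) ∂(stdGaussian E) := by
    have := integral_comp_add_stdGaussian (f := fun z => ψ (x + ε • z))
      (Continuous.stronglyMeasurable (by fun_prop)) b
    simp only [smul_eq_mul] at this
    rw [← this, gaussSmooth]
    congr 1 with z
    rw [hab, smul_add]
    congr 1
    abel
  have h2 : ⟪ε⁻¹ • ∫ z, ψ (x + ε • z) • z ∂(stdGaussian E), a⟫
      = ∫ z, ⟪z, b⟫ * ψ (x + ε • z) ∂(stdGaussian E) := by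
    rw [real_inner_smul_left, ← real_inner_smul_right, ← hb, real_inner_comm, ← integral_inner hint]
    congr 1 with z
    rw [real_inner_smul_right, real_inner_comm, mul_comm]
  have i1 : Integrable (fun z => shiftDensity b z * ψ (x + ε • z)) (stdGaussian E) :=
    (integrable_shiftDensity b).mul_bdd (c := B) (Continuous.aestronglyMeasurable (by fun_prop))
      (ae_of_all _ fun z => hB _)
  have i2 := integrable_comp_add_smul (ε := ε) hψ hB x
  have i3 : Integrable (fun z => ⟪z, b⟫ * ψ (x + ε • z)) (stdGaussian E) :=
    (IsGaussian.integrable_id (μ := stdGaussian E)).inner_const b |>.mul_bdd (c := B)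
      (Continuous.aestronglyMeasurable (by fun_prop)) (ae_of_all _ fun z => hB _)
  have i4 : ∫ z, (shiftDensity b z * ψ (x + ε • z) - ψ (x + ε • z)) ∂(stdGaussian E)
      - ∫ z, ⟪z, b⟫ * ψ (x + ε • z) ∂(stdGaussian E)
      = ∫ z, (shiftDensity b z * ψ (x + ε • z) - ψ (x + ε • z) - ⟪z, b⟫ * ψ (x + ε • z))
        ∂(stdGaussian E) := (integral_sub (i1.sub i2) i3).symm
  rw [h1, h2, gaussSmooth, ← integral_sub i1 i2, i4]
  have h3 : B * expansionConst E / ε ^ 2 * ‖a‖ ^ 2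
      = ∫ z : E, B * ‖b‖ ^ 2 * (2 * Real.exp (3 * (‖z‖ + 1))) ∂(stdGaussian E) := by
    rw [integral_const_mul, hb, norm_smul, norm_inv, Real.norm_eq_abs, abs_of_pos hε]
    change _ = _ * expansionConst E
    field_simp
  rw [h3, ← Real.norm_eq_abs]
  refine norm_integral_le_of_norm_le ((integrable_expansionConst (E := E)).const_mul _)
    (ae_of_all _ fun z => ?_)
  have h4 : shiftDensity b z * ψ (x + ε • z) - ψ (x + ε • z) - ⟪z, b⟫ * ψ (x + ε • z)
      = ψ (x + ε • z) * (shiftDensity b z - 1 - ⟪z, b⟫) := by ring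
  rw [Real.norm_eq_abs]
  rw [h4, abs_mul, mul_assoc]
  gcongr
  · exact hB _
  · exact abs_shiftDensity_sub_le hb1 z

end Smoothing

end ProbFlow

namespace ProbFlow

/-! ### Weak convergence of the Euler scheme to the mixture law. -/

section EulerLaw

set_option linter.unusedSectionVars false

variable {E : Type*} [NormedAddCommGroup E] [InnerProductSpace ℝ E] [FiniteDimensional ℝ E]
  [MeasurableSpace E] [BorelSpace E] {ν : Measure E} [IsProbabilityMeasure ν] {K R L : ℝ}
  {ψ : E → ℝ} {B Λ ε : ℝ}

theorem integrable_of_continuous_bounded {α : Type*} [TopologicalSpace α] [MeasurableSpace α]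
    [OpensMeasurableSpace α] {μ : Measure α} [IsFiniteMeasure μ] {f : α → ℝ}
    (hf : Continuous f) (hB : ∀ x, |f x| ≤ B) : Integrable f μ :=
  Integrable.of_bound hf.measurable.aestronglyMeasurable B (ae_of_all _ hB)

/-- Mollification and an Euler step almost commute: the commutator sees only the variation of `b`
over distance `ε ‖z‖`. The factor `h` keeps the sum over all steps of order `ε`. -/
theorem abs_gaussSmooth_eulerStep_sub_le {b : E → E} (hb : ∀ x y, ‖b x - b y‖ ≤ L * ‖x - y‖)
    (hbc : Continuous b) {h : ℝ}
    (hh : 0 ≤ h) (hΛ0 : 0 ≤ Λ) (hΛ : ∀ x y, |ψ x - ψ y| ≤ Λ * ‖x - y‖) (hB : ∀ x, |ψ x| ≤ B)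
    (hε : 0 ≤ ε) (x : E) :
    |gaussSmooth ε (fun x => ψ (x + h • b x)) x - gaussSmooth ε ψ (x + h • b x)|
      ≤ Λ * h * L * ε * ∫ z : E, ‖z‖ ∂(stdGaussian E) := by
  have hψ := continuous_of_abs_sub_le hΛ
  have i1 := integrable_comp_add_smul (ε := ε) (ψ := fun x => ψ (x + h • b x)) (B := B)
    (by fun_prop) (fun _ => hB _) x
  rw [gaussSmooth, gaussSmooth, ← integral_sub i1 (integrable_comp_add_smul hψ hB _),
    ← integral_const_mul, ← Real.norm_eq_abs]
  refine norm_integral_le_of_norm_le (integrable_norm_stdGaussian.const_mul _)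
    (ae_of_all _ fun z => (hΛ _ _).trans ?_)
  have e : x + ε • z + h • b (x + ε • z) - (x + h • b x + ε • z)
      = h • (b (x + ε • z) - b x) := by
    rw [smul_sub]
    abel
  have h1 := hb (x + ε • z) x
  rw [add_sub_cancel_left, norm_smul, Real.norm_eq_abs, abs_of_nonneg hε] at h1
  rw [e, norm_smul, Real.norm_eq_abs, abs_of_nonneg hh]
  calc Λ * (h * ‖b (x + ε • z) - b x‖) ≤ Λ * (h * (L * (ε * ‖z‖))) := by gcongr
    _ = _ := by ring

/-- Expand both terms around `x`. The linear parts differ by a multiple of `v - posteriorMean ν r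
x`, which integrates to zero, so two quadratic remainders are left. The condition `h K ≤ ε` keeps
both displacements in the range of the expansion. -/
theorem abs_integral_shiftDensity_mul_le (hν : ∀ᵐ v ∂ν, ‖v‖ ≤ K) {r h : ℝ}
    (hh : 0 ≤ h) (hψ : Continuous ψ) (hB : ∀ x, |ψ x| ≤ B)
    (hε : 0 < ε) (hhε : h * K ≤ ε) (x : E) :
    |∫ v, shiftDensity (r • v) x * (gaussSmooth ε ψ (x + h • posteriorMean ν r x)
        - gaussSmooth ε ψ (x + h • v)) ∂ν|
      ≤ mixtureDensity ν r x * (2 * B * expansionConst E / ε ^ 2 * (h * K) ^ 2) := by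
  have hK := nonneg_of_ae_norm_le hν
  have hB0 : 0 ≤ B := (abs_nonneg _).trans (hB 0)
  obtain ⟨l, hl⟩ := exists_gaussSmooth_expansion hψ hB hε x
  set D := posteriorMean ν r x with hD
  set κ := B * expansionConst E / ε ^ 2 with hκ
  have hκ0 : 0 ≤ κ := by
    have := expansionConst_nonneg (E := E)
    positivity
  have hi := integrable_shiftDensity_smul_apply hν r x
  have hiv : Integrable (fun v => shiftDensity (r • v) x • (v - D)) ν := by
    simp_rw [smul_sub]
    exact (integrable_shiftDensity_smul_smul hν r x).sub (hi.smul_const _)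
  have hzero : ∫ v, ⟪h • l, shiftDensity (r • v) x • (v - D)⟫ ∂ν = 0 := by
    rw [integral_inner hiv, integral_shiftDensity_smul_sub_posteriorMean hν r x, inner_zero_right]
  have hsmall : ∀ v : E, ‖v‖ ≤ K →
      |gaussSmooth ε ψ (x + h • v) - gaussSmooth ε ψ x - ⟪l, h • v⟫| ≤ κ * (h * K) ^ 2 := by
    intro v hv
    have h1 : ‖h • v‖ ≤ h * K := by
      rw [norm_smul, Real.norm_eq_abs, abs_of_nonneg hh]
      gcongr
    refine (hl (h • v) (h1.trans hhε)).trans ?_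
    gcongr
  have hS : Continuous (gaussSmooth ε ψ) := by
    refine continuous_of_dominated (bound := fun _ => B) (fun x => ?_) (fun x => ?_)
      (integrable_const _) (ae_of_all _ fun z => by fun_prop)
    · exact Continuous.aestronglyMeasurable (by fun_prop)
    · exact ae_of_all _ fun z => hB _
  have hSb := abs_gaussSmooth_le (ε := ε) hB
  have i1 : Integrable (fun v => shiftDensity (r • v) x * (gaussSmooth ε ψ (x + h • D)
        - gaussSmooth ε ψ (x + h • v))) ν := by
    refine hi.mul_bdd (c := B + B) (Continuous.aestronglyMeasurable (by fun_prop))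
      (ae_of_all _ fun v => ?_)
    exact (norm_sub_le _ _).trans (add_le_add (hSb _) (hSb _))
  have i2 : Integrable (fun v => ⟪h • l, shiftDensity (r • v) x • (v - D)⟫) ν :=
    hiv.const_inner _
  have hsum : ∫ v, shiftDensity (r • v) x * (gaussSmooth ε ψ (x + h • D)
        - gaussSmooth ε ψ (x + h • v)) ∂ν
      = ∫ v, (shiftDensity (r • v) x * (gaussSmooth ε ψ (x + h • D)
        - gaussSmooth ε ψ (x + h • v)) + ⟪h • l, shiftDensity (r • v) x • (v - D)⟫) ∂ν := by
    rw [integral_add i1 i2, hzero, add_zero]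
  rw [hsum]
  have hm : mixtureDensity ν r x * (2 * B * expansionConst E / ε ^ 2 * (h * K) ^ 2)
      = ∫ v, shiftDensity (r • v) x * (2 * (κ * (h * K) ^ 2)) ∂ν := by
    rw [integral_mul_const, hκ]
    change mixtureDensity ν r x * _ = mixtureDensity ν r x * _
    ring
  rw [hm, ← Real.norm_eq_abs]
  refine norm_integral_le_of_norm_le (hi.mul_const _) ?_
  filter_upwards [hν] with v hv
  have e : shiftDensity (r • v) x * (gaussSmooth ε ψ (x + h • D)
        - gaussSmooth ε ψ (x + h • v)) + ⟪h • l, shiftDensity (r • v) x • (v - D)⟫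
      = shiftDensity (r • v) x * ((gaussSmooth ε ψ (x + h • D) - gaussSmooth ε ψ x - ⟪l, h • D⟫)
        - (gaussSmooth ε ψ (x + h • v) - gaussSmooth ε ψ x - ⟪l, h • v⟫)) := by
    simp only [real_inner_smul_right, real_inner_smul_left, inner_sub_right]
    ring
  rw [e, norm_mul, Real.norm_eq_abs, Real.norm_eq_abs, abs_of_pos (shiftDensity_pos _ _)]
  refine mul_le_mul_of_nonneg_left ?_ (shiftDensity_pos _ _).le
  rw [two_mul]
  exact (abs_sub _ _).trans <| add_le_add (hsmall D (norm_posteriorMean_le hν r x)) (hsmall v hv)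

/-- The error of one Euler step in the evolution of the laws `mixtureLaw ν r`, tested against a
mollified function. -/
theorem abs_integral_eulerStep_sub_le (hν : ∀ᵐ v ∂ν, ‖v‖ ≤ K) {r h : ℝ} (hr : 0 ≤ r)
    (hh : 0 ≤ h) (hL : K ^ 2 * r ≤ L) (hΛ0 : 0 ≤ Λ)
    (hΛ : ∀ x y, |ψ x - ψ y| ≤ Λ * ‖x - y‖) (hB : ∀ x, |ψ x| ≤ B)
    (hε : 0 < ε) (hhε : h * K ≤ ε) :
    |∫ x, gaussSmooth ε (fun x => ψ (x + h • posteriorMean ν r x)) x ∂(mixtureLaw ν r)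
        - ∫ x, gaussSmooth ε ψ x ∂(mixtureLaw ν (r + h))|
      ≤ Λ * h * L * ε * (∫ z : E, ‖z‖ ∂(stdGaussian E))
        + 2 * B * expansionConst E / ε ^ 2 * (h * K) ^ 2 := by
  have hψ := continuous_of_abs_sub_le hΛ
  have hDc := continuous_posteriorMean hν hr
  have hD : ∀ x y, ‖posteriorMean ν r x - posteriorMean ν r y‖ ≤ L * ‖x - y‖ := fun x y =>
    (norm_posteriorMean_sub_le hν hr x y).trans (by gcongr)
  set D := posteriorMean ν r with hDdef
  have hSb := abs_gaussSmooth_le (ε := ε) hB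
  have hS : Continuous (gaussSmooth ε ψ) :=
    continuous_of_abs_sub_le (abs_gaussSmooth_sub_le (ε := ε) hΛ hB)
  have hS' : Continuous (gaussSmooth ε (fun x => ψ (x + h • D x))) := by
    refine continuous_of_dominated (bound := fun _ => B) (fun x => ?_) (fun x => ?_)
      (integrable_const _) (ae_of_all _ fun z => by fun_prop)
    · exact Continuous.aestronglyMeasurable (by fun_prop)
    · exact ae_of_all _ fun z => hB _
  have hSb' : ∀ x, |gaussSmooth ε (fun x => ψ (x + h • D x)) x| ≤ B :=
    abs_gaussSmooth_le fun x => hB _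
  set F : E → E → ℝ := fun x v => gaussSmooth ε ψ (x + h • D x) - gaussSmooth ε ψ (x + h • v)
    with hF
  have hFc : Continuous (Function.uncurry F) := by
    rw [hF]
    unfold Function.uncurry
    fun_prop
  have hFb : ∀ x v, |F x v| ≤ B + B := fun x v =>
    (abs_sub _ _).trans (add_le_add (hSb _) (hSb _))
  have h1 : ∫ x, gaussSmooth ε ψ x ∂(mixtureLaw ν (r + h))
      = ∫ p, gaussSmooth ε ψ (p.2 + r • p.1 + h • p.1) ∂(ν.prod (stdGaussian E)) := by
    rw [integral_mixtureLaw _ hS.measurable]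
    congr 1 with p
    rw [add_smul, add_assoc]
  have h2 : ∫ x, gaussSmooth ε ψ (x + h • D x) ∂(mixtureLaw ν r)
      - ∫ x, gaussSmooth ε ψ x ∂(mixtureLaw ν (r + h))
      = ∫ x, ∫ v, shiftDensity (r • v) x * F x v ∂ν ∂(stdGaussian E) := by
    rw [← integral_prod_comp_add_smul r hFc.measurable hFb, h1,
      integral_mixtureLaw r (f := fun x => gaussSmooth ε ψ (x + h • D x)) (by fun_prop),
      ← integral_sub]
    · exact integrable_of_continuous_bounded (by fun_prop) fun _ => hSb _
    · exact integrable_of_continuous_bounded (by fun_prop) fun _ => hSb _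
  have h3 : |∫ x, ∫ v, shiftDensity (r • v) x * F x v ∂ν ∂(stdGaussian E)|
      ≤ 2 * B * expansionConst E / ε ^ 2 * (h * K) ^ 2 := by
    rw [← Real.norm_eq_abs]
    calc _ ≤ ∫ x, mixtureDensity ν r x * (2 * B * expansionConst E / ε ^ 2 * (h * K) ^ 2)
          ∂(stdGaussian E) :=
        norm_integral_le_of_norm_le ((integrable_mixtureDensity r).mul_const _)
          (ae_of_all _ fun x => abs_integral_shiftDensity_mul_le hν hh hψ hB hε hhε x)
      _ = _ := by rw [integral_mul_const, integral_mixtureDensity, one_mul]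
  have h4 : |∫ x, gaussSmooth ε (fun x => ψ (x + h • D x)) x ∂(mixtureLaw ν r)
      - ∫ x, gaussSmooth ε ψ (x + h • D x) ∂(mixtureLaw ν r)|
      ≤ Λ * h * L * ε * ∫ z : E, ‖z‖ ∂(stdGaussian E) := by
    rw [← integral_sub (integrable_of_continuous_bounded hS' hSb')
      (integrable_of_continuous_bounded (by fun_prop) fun _ => hSb _)]
    have := norm_integral_le_of_norm_le_const (μ := mixtureLaw ν r)
      (f := fun x => gaussSmooth ε (fun x => ψ (x + h • D x)) x - gaussSmooth ε ψ (x + h • D x))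
      (ae_of_all _ fun x => abs_gaussSmooth_eulerStep_sub_le hD hDc hh hΛ0 hΛ hB hε.le x)
    simpa using this
  -- The intermediate term separates the commutator error from the conditional-mean error.
  rw [← sub_add_sub_cancel _ (∫ x, gaussSmooth ε ψ (x + h • D x) ∂(mixtureLaw ν r)) _, h2]
  exact (abs_add_le _ _).trans (add_le_add h4 h3)

/-- A telescoping sum over the time steps. At each one the test function is `ψ` composed with the
remaining Euler flow, whose Lipschitz constant stays below `Λ'`; its sup bound `B` does not change.
-/
theorem abs_integral_eulerFlow_sub_le (hν : ∀ᵐ v ∂ν, ‖v‖ ≤ K) {h : ℝ}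
    (hh : 0 ≤ h) (hΛ0 : 0 ≤ Λ) (hΛ : ∀ x y, |ψ x - ψ y| ≤ Λ * ‖x - y‖)
    (hB : ∀ x, |ψ x| ≤ B) (hε : 0 < ε) (hhε : h * K ≤ ε) (m : ℕ) {Λ' : ℝ}
    (hΛ' : (1 + h * (K ^ 2 * R)) ^ m * Λ ≤ Λ') :
    ∀ k : ℕ, (k + m : ℕ) * h ≤ R →
      |∫ x, gaussSmooth ε (fun x => ψ (eulerFlow (posteriorMean ν) h k m x)) x
          ∂(mixtureLaw ν (k * h))
        - ∫ x, gaussSmooth ε ψ x ∂(mixtureLaw ν ((k + m : ℕ) * h))|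
      ≤ m * (Λ' * h * (K ^ 2 * R) * ε * (∫ z : E, ‖z‖ ∂(stdGaussian E))
        + 2 * B * expansionConst E / ε ^ 2 * (h * K) ^ 2) := by
  induction m with
  | zero => intro k _; simp [eulerFlow]
  | succ m ih =>
    intro k hk
    have hk1 : (k + 1 + m : ℕ) * h ≤ R := by rwa [add_right_comm, add_assoc]
    have hR : 0 ≤ R := le_trans (by positivity) hk
    have hL : 0 ≤ K ^ 2 * R := by positivity
    have hkR : k * h ≤ R := by
      refine le_trans ?_ hk
      gcongr
      exact le_self_add
    have hpow : (1 + h * (K ^ 2 * R)) ^ m * Λ ≤ Λ' := by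
      refine le_trans ?_ hΛ'
      gcongr
      · nlinarith [mul_nonneg hh hL]
      · exact Nat.le_succ m
    have hD : ∀ r ∈ Set.Icc 0 R, ∀ x y,
        ‖posteriorMean ν r x - posteriorMean ν r y‖ ≤ K ^ 2 * R * ‖x - y‖ := fun r hr x y =>
      (norm_posteriorMean_sub_le hν hr.1 x y).trans (by gcongr; exact hr.2)
    have hlip : ∀ x y, |ψ (eulerFlow (posteriorMean ν) h (k + 1) m x)
        - ψ (eulerFlow (posteriorMean ν) h (k + 1) m y)| ≤ Λ' * ‖x - y‖ := by
      intro x y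
      refine (hΛ _ _).trans ?_
      calc _ ≤ Λ * ((1 + h * (K ^ 2 * R)) ^ m * ‖x - y‖) := by
            gcongr
            exact norm_eulerFlow_sub_le hh hL hD m (k + 1) hk1 x y
        _ = (1 + h * (K ^ 2 * R)) ^ m * Λ * ‖x - y‖ := by ring
        _ ≤ _ := by gcongr
    have hΛ'0 : 0 ≤ Λ' := le_trans (by positivity) hpow
    have hstep := abs_integral_eulerStep_sub_le hν (r := k * h) (by positivity) hh
      (L := K ^ 2 * R) (by gcongr) hΛ'0 hlip (fun x => hB _) hε hhε
    have hrest := ih hpow (k + 1) hk1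
    have e1 : (k : ℝ) * h + h = (k + 1 : ℕ) * h := by push_cast; ring
    rw [e1] at hstep
    rw [show k + (m + 1) = k + 1 + m by ring, Nat.cast_succ m, add_mul, one_mul, add_comm (_ * _)]
    simp only [eulerFlow]
    refine le_trans ?_ (add_le_add hstep hrest)
    refine le_trans (le_of_eq ?_) (abs_add_le _ _)
    rw [sub_add_sub_cancel]

/-- For fixed `ε` the accumulated quadratic errors are `O(1/n)`. The commutators and the removal of
the mollifier at both ends cost `ε Q`. Hence `ε` is chosen first, and `n` afterwards. -/
theorem tendsto_integral_eulerFlow (hν : ∀ᵐ v ∂ν, ‖v‖ ≤ K) (hR : 0 ≤ R) (hΛ0 : 0 ≤ Λ)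
    (hΛ : ∀ x y, |ψ x - ψ y| ≤ Λ * ‖x - y‖) (hB : ∀ x, |ψ x| ≤ B) :
    Tendsto (fun n : ℕ => ∫ x, ψ (eulerFlow (posteriorMean ν) (R / n) 0 n x) ∂(stdGaussian E))
      atTop (𝓝 (∫ x, ψ x ∂(mixtureLaw ν R))) := by
  have hK := nonneg_of_ae_norm_le hν
  have hL : 0 ≤ K ^ 2 * R := by positivity
  set c := ∫ z : E, ‖z‖ ∂(stdGaussian E) with hc
  have hc0 : 0 ≤ c := integral_nonneg fun _ => norm_nonneg _
  set Λ' := Real.exp (R * (K ^ 2 * R)) * Λ with hΛ'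
  have hΛ'0 : 0 ≤ Λ' := by positivity
  set Q := c * (Λ' + Λ + Λ' * R * (K ^ 2 * R)) with hQ
  have hQ0 : 0 ≤ Q := by positivity
  have hD : ∀ r ∈ Set.Icc 0 R, ∀ x y,
      ‖posteriorMean ν r x - posteriorMean ν r y‖ ≤ K ^ 2 * R * ‖x - y‖ := fun r hr x y =>
    (norm_posteriorMean_sub_le hν hr.1 x y).trans (by gcongr; exact hr.2)
  have hψ := continuous_of_abs_sub_le hΛ
  have key : ∀ ε > 0, ∀ᶠ n : ℕ in atTop,
      |∫ x, ψ (eulerFlow (posteriorMean ν) (R / n) 0 n x) ∂(stdGaussian E)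
        - ∫ x, ψ x ∂(mixtureLaw ν R)|
      ≤ ε * Q + 2 * B * expansionConst E / ε ^ 2 * (R * K) ^ 2 * (n : ℝ)⁻¹ := by
    intro ε hε
    have hev : ∀ᶠ n : ℕ in atTop, (R * K) * (n : ℝ)⁻¹ ≤ ε := by
      have := (tendsto_inv_atTop_nhds_zero_nat (𝕜 := ℝ)).const_mul (R * K)
      rw [mul_zero] at this
      exact this.eventually_le_const hε
    filter_upwards [hev, eventually_gt_atTop 0] with n hn hn0
    have hn' : (n : ℝ) ≠ 0 := by positivity
    have hnR : ((0 + n : ℕ) : ℝ) * (R / n) = R := by rw [zero_add, mul_div_cancel₀ R hn']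
    have hpow : (1 + R / n * (K ^ 2 * R)) ^ n * Λ ≤ Λ' := by
      rw [hΛ']
      gcongr
      exact one_add_div_mul_pow_le hL hR le_rfl
    have h1 := abs_integral_eulerFlow_sub_le hν (h := R / n) (by positivity) hΛ0 hΛ hB hε
      (by rw [div_mul_eq_mul_div, div_eq_mul_inv]; exact hn) n hpow 0 hnR.le
    rw [hnR, Nat.cast_zero, zero_mul, mixtureLaw_zero] at h1
    have hlip : ∀ x y, |ψ (eulerFlow (posteriorMean ν) (R / n) 0 n x)
        - ψ (eulerFlow (posteriorMean ν) (R / n) 0 n y)| ≤ Λ' * ‖x - y‖ := by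
      intro x y
      refine (hΛ _ _).trans ?_
      calc _ ≤ Λ * ((1 + R / n * (K ^ 2 * R)) ^ n * ‖x - y‖) := by
            gcongr
            exact norm_eulerFlow_sub_le (by positivity) hL hD n 0 hnR.le x y
        _ = (1 + R / n * (K ^ 2 * R)) ^ n * Λ * ‖x - y‖ := by ring
        _ ≤ _ := by gcongr
    have smooth_close : ∀ (φ : E → ℝ) (M : ℝ) (μ : Measure E) [IsProbabilityMeasure μ],
        (∀ x y, |φ x - φ y| ≤ M * ‖x - y‖) → (∀ x, |φ x| ≤ B) →
        |∫ x, gaussSmooth ε φ x ∂μ - ∫ x, φ x ∂μ| ≤ M * ε * c := by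
      intro φ M μ _ hM hφB
      have hφ := continuous_of_abs_sub_le hM
      rw [← integral_sub (integrable_of_continuous_bounded
          (continuous_of_abs_sub_le (abs_gaussSmooth_sub_le hM hφB)) (abs_gaussSmooth_le hφB))
        (integrable_of_continuous_bounded hφ hφB)]
      have := norm_integral_le_of_norm_le_const (μ := μ)
        (f := fun x => gaussSmooth ε φ x - φ x)
        (ae_of_all _ fun x => abs_gaussSmooth_sub_self_le hM hφB hε.le x)
      simpa using this
    have h2 := smooth_close (fun x => ψ (eulerFlow (posteriorMean ν) (R / n) 0 n x)) Λ'
      (stdGaussian E) hlip fun _ => hB _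
    have h3 := smooth_close ψ Λ (mixtureLaw ν R) hΛ hB
    have h4 : (n : ℝ) * (Λ' * (R / n) * (K ^ 2 * R) * ε * c
        + 2 * B * expansionConst E / ε ^ 2 * (R / n * K) ^ 2)
        = Λ' * R * (K ^ 2 * R) * ε * c
          + 2 * B * expansionConst E / ε ^ 2 * (R * K) ^ 2 * (n : ℝ)⁻¹ := by
      field_simp
    rw [h4] at h1
    rw [abs_le] at h1 h2 h3 ⊢
    rw [hQ]
    constructor <;> linarith [h1.1, h1.2, h2.1, h2.2, h3.1, h3.2]
  rw [Metric.tendsto_nhds]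
  intro δ hδ
  obtain ⟨ε, hε, hεQ⟩ : ∃ ε > 0, ε * Q < δ / 2 := by
    refine ⟨δ / (4 * (Q + 1)), by positivity, ?_⟩
    rw [div_mul_eq_mul_div, div_lt_div_iff₀ (by positivity) (by positivity)]
    nlinarith
  have hev : ∀ᶠ n : ℕ in atTop,
      2 * B * expansionConst E / ε ^ 2 * (R * K) ^ 2 * (n : ℝ)⁻¹ < δ / 2 := by
    have := (tendsto_inv_atTop_nhds_zero_nat (𝕜 := ℝ)).const_mul
      (2 * B * expansionConst E / ε ^ 2 * (R * K) ^ 2)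
    rw [mul_zero] at this
    exact this.eventually_lt_const (half_pos hδ)
  filter_upwards [key ε hε, hev] with n h1 h2
  rw [Real.dist_eq]
  linarith

end EulerLaw

end ProbFlow

namespace ProbFlow

/-! ### Mean squared error of sample means. -/

section SampleMean

variable {α G : Type*} [MeasurableSpace α] {ν : Measure α} [IsProbabilityMeasure ν]
  [NormedAddCommGroup G] [InnerProductSpace ℝ G] [FiniteDimensional ℝ G] {N : ℕ}

/-- Jensen's inequality for the square, in the form that a variance is nonnegative. -/
theorem integrable_and_integral_le_of_sq_le {f : α → ℝ} {c : ℝ} (hf : AEStronglyMeasurable f ν)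
    (hi : Integrable (fun x => f x ^ 2) ν) (hc : 0 ≤ c) (h : ∫ x, f x ^ 2 ∂ν ≤ c ^ 2) :
    Integrable f ν ∧ ∫ x, f x ∂ν ≤ c := by
  have h2 : MemLp f 2 ν := (memLp_two_iff_integrable_sq hf).2 hi
  refine ⟨h2.integrable one_le_two, ?_⟩
  have h3 := variance_nonneg f ν
  rw [variance_eq_sub h2] at h3
  have h4 : ∫ x, (f ^ 2) x ∂ν = ∫ x, f x ^ 2 ∂ν := rfl
  rw [h4] at h3
  exact (abs_le_of_sq_le_sq' (by linarith) hc).2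

theorem integral_sampleMean_sub_sq_le_real (hN : 1 ≤ N) {f : α → ℝ} (hf : MemLp f 2 ν) :
    Integrable (fun η : Fin N → α => ((N : ℝ)⁻¹ * ∑ j, f (η j) - ∫ v, f v ∂ν) ^ 2)
        (Measure.pi fun _ => ν) ∧
      ∫ η : Fin N → α, ((N : ℝ)⁻¹ * ∑ j, f (η j) - ∫ v, f v ∂ν) ^ 2 ∂(Measure.pi fun _ => ν)
        ≤ (N : ℝ)⁻¹ * ∫ v, f v ^ 2 ∂ν := by
  have hN' : (N : ℝ) ≠ 0 := by positivity
  have hev : ∀ j : Fin N, MemLp (fun η : Fin N → α => f (η j)) 2 (Measure.pi fun _ => ν) :=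
    fun j => hf.comp_measurePreserving (measurePreserving_eval (fun _ => ν) j)
  have hsum : MemLp (fun η : Fin N → α => ∑ j, f (η j)) 2 (Measure.pi fun _ => ν) :=
    memLp_finsetSum _ fun j _ => hev j
  have hS := hsum.const_mul (N : ℝ)⁻¹
  have hmean : ∫ η : Fin N → α, (N : ℝ)⁻¹ * ∑ j, f (η j) ∂(Measure.pi fun _ => ν)
      = ∫ v, f v ∂ν := by
    rw [integral_const_mul, integral_finsetSum _ fun j _ => (hev j).integrable one_le_two]
    simp_rw [integral_comp_eval (μ := fun _ : Fin N => ν) hf.aestronglyMeasurable]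
    simp [hN']
  refine ⟨(hS.sub (memLp_const _)).integrable_sq, ?_⟩
  have hv : ∫ η : Fin N → α, ((N : ℝ)⁻¹ * ∑ j, f (η j) - ∫ v, f v ∂ν) ^ 2
        ∂(Measure.pi fun _ => ν)
      = Var[fun η : Fin N → α => (N : ℝ)⁻¹ * ∑ j, f (η j); Measure.pi fun _ => ν] := by
    rw [variance_eq_integral hS.aestronglyMeasurable.aemeasurable, hmean]
  have hvs := variance_sum_pi (μ := fun _ : Fin N => ν) (X := fun _ => f) fun _ => hf
  have e : (∑ i : Fin N, fun ω : Fin N → α => f (ω i)) = fun ω => ∑ i, f (ω i) := by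
    ext ω
    simp
  rw [e] at hvs
  rw [hv, variance_const_mul, hvs]
  simp only [Finset.sum_const, Finset.card_univ, Fintype.card_fin, nsmul_eq_mul]
  have := variance_le_expectation_sq (μ := ν) hf.aestronglyMeasurable
  calc ((N : ℝ)⁻¹) ^ 2 * (N * Var[f; ν]) = (N : ℝ)⁻¹ * Var[f; ν] := by field_simp
    _ ≤ _ := by
      gcongr
      exact this

/-- The mean squared error of a sample mean of `N` independent vectors. -/
theorem integral_sampleMean_sub_sq_le (hN : 1 ≤ N) {f : α → G} (hf : MemLp f 2 ν) :
    Integrable (fun η : Fin N → α => ‖(N : ℝ)⁻¹ • ∑ j, f (η j) - ∫ v, f v ∂ν‖ ^ 2)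
        (Measure.pi fun _ => ν) ∧
      ∫ η : Fin N → α, ‖(N : ℝ)⁻¹ • ∑ j, f (η j) - ∫ v, f v ∂ν‖ ^ 2 ∂(Measure.pi fun _ => ν)
        ≤ (N : ℝ)⁻¹ * ∫ v, ‖f v‖ ^ 2 ∂ν := by
  -- Summing the scalar estimate over orthonormal coordinates leaves no dimensional constant.
  set b := stdOrthonormalBasis ℝ G
  have hb : ∀ i, MemLp (fun v => ⟪b i, f v⟫) 2 ν := fun i => hf.const_inner (b i)
  have hsq : ∀ g : G, ‖g‖ ^ 2 = ∑ i, ⟪b i, g⟫ ^ 2 := fun g => (b.sum_sq_inner_right g).symm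
  have hcoord : ∀ (η : Fin N → α) i, ⟪b i, (N : ℝ)⁻¹ • ∑ j, f (η j) - ∫ v, f v ∂ν⟫
      = (N : ℝ)⁻¹ * ∑ j, ⟪b i, f (η j)⟫ - ∫ v, ⟪b i, f v⟫ ∂ν := by
    intro η i
    rw [inner_sub_right, real_inner_smul_right, inner_sum,
      integral_inner (hf.integrable one_le_two)]
  simp_rw [hsq, hcoord]
  have key := fun i => integral_sampleMean_sub_sq_le_real hN (hb i)
  refine ⟨integrable_finsetSum _ fun i _ => (key i).1, ?_⟩
  rw [integral_finsetSum _ fun i _ => (key i).1,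
    integral_finsetSum _ fun i _ => (hb i).integrable_sq, Finset.mul_sum]
  exact Finset.sum_le_sum fun i _ => (key i).2

end SampleMean

/-! ### Statistical error of the empirical posterior mean. -/

section Empirical

variable {d N : ℕ} {ν : Measure (EuclideanSpace ℝ (Fin d))} {K : ℝ}

theorem isProbabilityMeasure_empiricalMeasure (hN : 1 ≤ N)
    (η : Fin N → EuclideanSpace ℝ (Fin d)) : IsProbabilityMeasure (empiricalMeasure η) := by
  constructor
  simp only [empiricalMeasure, Measure.smul_apply, Measure.finsetSum_apply, measure_univ,
    Finset.sum_const, Finset.card_univ, Fintype.card_fin, nsmul_eq_mul, mul_one, smul_eq_mul]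
  exact ENNReal.inv_mul_cancel (by simp; omega) (by simp)

theorem ae_empiricalMeasure {η : Fin N → EuclideanSpace ℝ (Fin d)}
    {p : EuclideanSpace ℝ (Fin d) → Prop} (hp : MeasurableSet {x | p x}) (h : ∀ j, p (η j)) :
    ∀ᵐ v ∂(empiricalMeasure η), p v := by
  refine Measure.ae_smul_measure ?_ _
  rw [ae_finsetSum_measure_iff]
  intro j _
  rw [ae_dirac_iff hp]
  exact h j

theorem integral_empiricalMeasure {G : Type*} [NormedAddCommGroup G] [NormedSpace ℝ G]
    [CompleteSpace G] (η : Fin N → EuclideanSpace ℝ (Fin d)) (f : EuclideanSpace ℝ (Fin d) → G) :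
    ∫ v, f v ∂(empiricalMeasure η) = (N : ℝ)⁻¹ • ∑ j, f (η j) := by
  rw [empiricalMeasure, integral_smul_measure,
    integral_finsetSum_measure fun j _ => integrable_dirac (by simp)]
  simp

theorem mixtureDensity_empiricalMeasure (η : Fin N → EuclideanSpace ℝ (Fin d)) (r : ℝ)
    (x : EuclideanSpace ℝ (Fin d)) :
    mixtureDensity (empiricalMeasure η) r x = (N : ℝ)⁻¹ * ∑ j, shiftDensity (r • η j) x :=
  integral_empiricalMeasure η _

theorem measurable_posteriorMean_empiricalMeasure (r : ℝ) :
    Measurable fun p : EuclideanSpace ℝ (Fin d) × (Fin N → EuclideanSpace ℝ (Fin d)) =>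
      posteriorMean (empiricalMeasure p.2) r p.1 := by
  simp_rw [posteriorMean_eq, mixtureDensity_empiricalMeasure, integral_empiricalMeasure,
    shiftDensity]
  fun_prop

variable [IsProbabilityMeasure ν]

theorem ae_pi_norm_le (hν : ∀ᵐ v ∂ν, ‖v‖ ≤ K) :
    ∀ᵐ η : Fin N → EuclideanSpace ℝ (Fin d) ∂(Measure.pi fun _ => ν), ∀ j, ‖η j‖ ≤ K := by
  rw [ae_all_iff]
  exact fun j => (measurePreserving_eval (fun _ => ν) j).quasiMeasurePreserving.ae hν

/-- Multiplying by the true density linearizes the difference of quotients: `M (D_N - D) = (M_N D_N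
- M D) - (M_N - M) D_N`. Since `‖D_N‖ ≤ K`, no lower bound on the random denominator `M_N` is
needed, and both terms are sample mean errors. -/
theorem mixtureDensity_mul_norm_sub_le (hN : 1 ≤ N) (hν : ∀ᵐ v ∂ν, ‖v‖ ≤ K)
    {η : Fin N → EuclideanSpace ℝ (Fin d)} (hη : ∀ j, ‖η j‖ ≤ K) (r : ℝ)
    (x : EuclideanSpace ℝ (Fin d)) :
    mixtureDensity ν r x * ‖posteriorMean (empiricalMeasure η) r x - posteriorMean ν r x‖
      ≤ ‖(N : ℝ)⁻¹ • ∑ j, shiftDensity (r • η j) x • η j - ∫ v, shiftDensity (r • v) x • v ∂ν‖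
        + K * ‖(N : ℝ)⁻¹ • ∑ j, shiftDensity (r • η j) x - ∫ v, shiftDensity (r • v) x ∂ν‖ := by
  have := isProbabilityMeasure_empiricalMeasure hN η
  have hη' : ∀ᵐ v ∂(empiricalMeasure η), ‖v‖ ≤ K :=
    ae_empiricalMeasure (measurableSet_le measurable_norm measurable_const) hη
  have hM := mixtureDensity_pos hν r x
  have hMN := mixtureDensity_pos hη' r x
  have hb := norm_posteriorMean_le hη' r x
  have e1 : mixtureDensity ν r x • posteriorMean ν r x = ∫ v, shiftDensity (r • v) x • v ∂ν := by
    rw [posteriorMean_eq, smul_inv_smul₀ hM.ne']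
  have e2 : mixtureDensity (empiricalMeasure η) r x • posteriorMean (empiricalMeasure η) r x
      = (N : ℝ)⁻¹ • ∑ j, shiftDensity (r • η j) x • η j := by
    rw [posteriorMean_eq, smul_inv_smul₀ hMN.ne', integral_empiricalMeasure]
  have e3 : (N : ℝ)⁻¹ • ∑ j, shiftDensity (r • η j) x - ∫ v, shiftDensity (r • v) x ∂ν
      = mixtureDensity (empiricalMeasure η) r x - mixtureDensity ν r x := by
    rw [mixtureDensity_empiricalMeasure]
    rfl
  rw [← e1, ← e2, e3]
  set M := mixtureDensity ν r x
  set MN := mixtureDensity (empiricalMeasure η) r x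
  set D := posteriorMean ν r x
  set DN := posteriorMean (empiricalMeasure η) r x
  calc M * ‖DN - D‖ = ‖M • (DN - D)‖ := by rw [norm_smul, Real.norm_eq_abs, abs_of_pos hM]
    _ = ‖(MN • DN - M • D) - (MN - M) • DN‖ := by
        congr 1
        module
    _ ≤ ‖MN • DN - M • D‖ + ‖MN - M‖ * ‖DN‖ := by
        rw [← norm_smul]
        exact norm_sub_le _ _
    _ ≤ ‖MN • DN - M • D‖ + K * ‖MN - M‖ := by
        rw [mul_comm K]
        gcongr

/-- The second moment of the density of `Z + r V` given `V`. -/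
theorem integral_integral_shiftDensity_sq_le (hν : ∀ᵐ v ∂ν, ‖v‖ ≤ K) (r : ℝ) :
    Integrable (fun x => ∫ v, shiftDensity (r • v) x ^ 2 ∂ν)
        (stdGaussian (EuclideanSpace ℝ (Fin d))) ∧
      ∫ x, ∫ v, shiftDensity (r • v) x ^ 2 ∂ν ∂(stdGaussian (EuclideanSpace ℝ (Fin d)))
        ≤ Real.exp (K ^ 2 * r ^ 2) := by
  have e : ∀ (v x : EuclideanSpace ℝ (Fin d)), shiftDensity (r • v) x ^ 2
      = Real.exp (-‖r • v‖ ^ 2) * Real.exp ⟪x, (2 : ℝ) • r • v⟫ := by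
    intro v x
    rw [shiftDensity, ← Real.exp_nat_mul, ← Real.exp_add, real_inner_smul_right _ _ (2 : ℝ)]
    congr 1
    push_cast
    ring
  -- With `a = r v`, the square contributes `exp (-‖a‖²)` and the moment of `exp ⟪x, 2 a⟫`
  -- contributes `exp (2 ‖a‖²)`.
  have hx : ∀ v : EuclideanSpace ℝ (Fin d),
      ∫ x, shiftDensity (r • v) x ^ 2 ∂(stdGaussian (EuclideanSpace ℝ (Fin d)))
        = Real.exp (‖r • v‖ ^ 2) := by
    intro v
    simp_rw [e]
    rw [integral_const_mul, integral_exp_inner_stdGaussian, ← Real.exp_add, norm_smul (2 : ℝ), Real.norm_two]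
    congr 1
    ring
  have hb : ∀ᵐ v ∂ν, Real.exp (‖r • v‖ ^ 2) ≤ Real.exp (K ^ 2 * r ^ 2) := by
    filter_upwards [hν] with v hv
    rw [norm_smul, mul_pow, Real.norm_eq_abs, sq_abs, mul_comm]
    gcongr
  have hint : Integrable (fun v => Real.exp (‖r • v‖ ^ 2)) ν := by
    refine Integrable.of_bound (C := Real.exp (K ^ 2 * r ^ 2))
      (Measurable.aestronglyMeasurable (by fun_prop)) ?_
    filter_upwards [hb] with v hv
    rwa [Real.norm_eq_abs, Real.abs_exp]
  have hprod : Integrable (fun p : EuclideanSpace ℝ (Fin d) × EuclideanSpace ℝ (Fin d) =>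
      shiftDensity (r • p.1) p.2 ^ 2) (ν.prod (stdGaussian _)) := by
    rw [integrable_prod_iff ((measurable_shiftDensity_smul r).pow_const 2).aestronglyMeasurable]
    constructor
    · refine ae_of_all _ fun v => ?_
      simp_rw [e]
      exact (integrable_exp_inner_stdGaussian _).const_mul _
    · simp_rw [norm_pow, Real.norm_eq_abs, sq_abs, hx]
      exact hint
  refine ⟨hprod.integral_prod_right, ?_⟩
  rw [← integral_integral_swap (f := fun v x => shiftDensity (r • v) x ^ 2) hprod]
  simp_rw [hx]
  calc _ ≤ ∫ _, Real.exp (K ^ 2 * r ^ 2) ∂ν := integral_mono_ae hint (integrable_const _) hb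
    _ = _ := by simp

theorem memLp_of_ae_exp_bound {G : Type*} [NormedAddCommGroup G] [NormedSpace ℝ G]
    (hν : ∀ᵐ v ∂ν, ‖v‖ ≤ K) (r : ℝ) (x : EuclideanSpace ℝ (Fin d))
    {V : EuclideanSpace ℝ (Fin d) → G} {C : ℝ} (hV : AEStronglyMeasurable V ν)
    (hC : ∀ᵐ v ∂ν, ‖V v‖ ≤ C) : MemLp (fun v => shiftDensity (r • v) x • V v) 2 ν := by
  obtain ⟨A, hA⟩ := exists_abs_exponent_le hν r x
  have hm : Measurable fun v => shiftDensity (r • v) x :=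
    (measurable_shiftDensity_smul r).comp (by fun_prop : Measurable fun v => (v, x))
  refine MemLp.of_bound (hm.aestronglyMeasurable.smul hV) (Real.exp A * C) ?_
  filter_upwards [hA, hC] with v h1 h2
  rw [norm_smul, Real.norm_eq_abs, shiftDensity, Real.abs_exp]
  gcongr
  exact (le_abs_self _).trans h1

/-- The numerator and the denominator each contribute `K √(Q / N)`, where `Q` is the second moment
of the likelihood at `x`; this is the source of the factor 2. -/
theorem mixtureDensity_mul_integral_norm_sub_le (hN : 1 ≤ N) (hν : ∀ᵐ v ∂ν, ‖v‖ ≤ K) (r : ℝ)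
    (x : EuclideanSpace ℝ (Fin d)) :
    mixtureDensity ν r x * ∫ η : Fin N → EuclideanSpace ℝ (Fin d),
        ‖posteriorMean (empiricalMeasure η) r x - posteriorMean ν r x‖ ∂(Measure.pi fun _ => ν)
      ≤ 2 * K / √N * √(∫ v, shiftDensity (r • v) x ^ 2 ∂ν) := by
  have hK := nonneg_of_ae_norm_le hν
  set Q := ∫ v, shiftDensity (r • v) x ^ 2 ∂ν with hQ
  have hQ0 : 0 ≤ Q := integral_nonneg fun v => sq_nonneg _
  have hm1 := memLp_of_ae_exp_bound hν r x (V := fun v => v) (by fun_prop) hν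
  have hm2 : MemLp (fun v => shiftDensity (r • v) x) 2 ν := by
    simpa using memLp_of_ae_exp_bound hν r x (V := fun _ => (1 : ℝ)) (C := 1) (by fun_prop)
      (by simp)
  have hsqrt : (√Q / √N) ^ 2 = (N : ℝ)⁻¹ * Q := by
    rw [div_pow, Real.sq_sqrt hQ0, Real.sq_sqrt (Nat.cast_nonneg N), div_eq_inv_mul]
  obtain ⟨i1, h1⟩ := integral_sampleMean_sub_sq_le hN hm1
  obtain ⟨i2, h2⟩ := integral_sampleMean_sub_sq_le hN hm2
  have hm : Measurable fun v => shiftDensity (r • v) x :=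
    (measurable_shiftDensity_smul r).comp (by fun_prop : Measurable fun v => (v, x))
  have b1 : ∫ v, ‖shiftDensity (r • v) x • v‖ ^ 2 ∂ν ≤ K ^ 2 * Q := by
    rw [hQ, ← integral_const_mul]
    refine integral_mono_ae ?_ (hm2.integrable_sq.const_mul _) ?_
    · exact hm1.integrable_norm_pow (by norm_num)
    · filter_upwards [hν] with v hv
      rw [norm_smul, mul_pow, Real.norm_eq_abs, sq_abs, mul_comm]
      gcongr
  have c1 := integrable_and_integral_le_of_sq_le (c := K * (√Q / √N)) (ν := Measure.pi fun _ => ν)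
    (f := fun η : Fin N → EuclideanSpace ℝ (Fin d) =>
      ‖(N : ℝ)⁻¹ • ∑ j, shiftDensity (r • η j) x • η j - ∫ v, shiftDensity (r • v) x • v ∂ν‖)
    (Measurable.aestronglyMeasurable (by unfold shiftDensity; fun_prop)) i1 (by positivity) (by
      rw [mul_pow, hsqrt]
      refine h1.trans ?_
      calc (N : ℝ)⁻¹ * _ ≤ (N : ℝ)⁻¹ * (K ^ 2 * Q) := by gcongr
        _ = _ := by ring)
  have c2 := integrable_and_integral_le_of_sq_le (c := √Q / √N) (ν := Measure.pi fun _ => ν)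
    (f := fun η : Fin N → EuclideanSpace ℝ (Fin d) =>
      ‖(N : ℝ)⁻¹ • ∑ j, shiftDensity (r • η j) x - ∫ v, shiftDensity (r • v) x ∂ν‖)
    (Measurable.aestronglyMeasurable (by unfold shiftDensity; fun_prop)) i2 (by positivity) (by
      rw [hsqrt]
      refine h2.trans_eq ?_
      simp_rw [Real.norm_eq_abs, sq_abs]
      rfl)
  rw [← integral_const_mul]
  calc _ ≤ ∫ η : Fin N → EuclideanSpace ℝ (Fin d),
        (‖(N : ℝ)⁻¹ • ∑ j, shiftDensity (r • η j) x • η j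
            - ∫ v, shiftDensity (r • v) x • v ∂ν‖
          + K * ‖(N : ℝ)⁻¹ • ∑ j, shiftDensity (r • η j) x - ∫ v, shiftDensity (r • v) x ∂ν‖)
        ∂(Measure.pi fun _ => ν) := by
        refine integral_mono_of_nonneg (ae_of_all _ fun η => ?_) (c1.1.add (c2.1.const_mul K)) ?_
        · exact mul_nonneg (mixtureDensity_pos hν r x).le (norm_nonneg _)
        · filter_upwards [ae_pi_norm_le hν] with η hη
          exact mixtureDensity_mul_norm_sub_le hN hν hη r x
    _ ≤ K * (√Q / √N) + K * (√Q / √N) := by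
        rw [integral_add c1.1 (c2.1.const_mul K), integral_const_mul]
        gcongr
        · exact c1.2
        · exact c2.2
    _ = _ := by ring

/-- The mean error of the empirical posterior mean along the marginal laws of the flow. -/
theorem integral_norm_posteriorMean_sub_le (hN : 1 ≤ N) (hν : ∀ᵐ v ∂ν, ‖v‖ ≤ K) (r : ℝ) :
    ∫ p, ‖posteriorMean ν r p.1 - posteriorMean (empiricalMeasure p.2) r p.1‖
        ∂((mixtureLaw ν r).prod (Measure.pi fun _ : Fin N => ν))
      ≤ 2 * K / √N * Real.exp (K ^ 2 * r ^ 2 / 2) := by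
  have hK := nonneg_of_ae_norm_le hν
  have hb : ∀ x : EuclideanSpace ℝ (Fin d), ∀ η : Fin N → EuclideanSpace ℝ (Fin d),
      (∀ j, ‖η j‖ ≤ K) →
      ‖posteriorMean ν r x - posteriorMean (empiricalMeasure η) r x‖ ≤ K + K := by
    intro x η hη
    have := isProbabilityMeasure_empiricalMeasure hN η
    have hη' : ∀ᵐ v ∂(empiricalMeasure η), ‖v‖ ≤ K :=
      ae_empiricalMeasure (measurableSet_le measurable_norm measurable_const) hη
    exact (norm_sub_le _ _).trans
      (add_le_add (norm_posteriorMean_le hν r x) (norm_posteriorMean_le hη' r x))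
  have hDm : Measurable (posteriorMean ν r) := by
    have h1 : StronglyMeasurable fun x => ∫ v, shiftDensity (r • v) x • v ∂ν := by
      refine StronglyMeasurable.integral_prod_right (f := fun x v => shiftDensity (r • v) x • v) ?_
      exact Measurable.stronglyMeasurable (by unfold shiftDensity Function.uncurry; fun_prop)
    have h2 : StronglyMeasurable fun x => ∫ v, shiftDensity (r • v) x ∂ν := by
      refine StronglyMeasurable.integral_prod_right (f := fun x v => shiftDensity (r • v) x) ?_
      exact Measurable.stronglyMeasurable (by unfold shiftDensity Function.uncurry; fun_prop)
    exact h2.measurable.inv.smul h1.measurable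
  have hG : Measurable fun p : EuclideanSpace ℝ (Fin d) × (Fin N → EuclideanSpace ℝ (Fin d)) =>
      ‖posteriorMean ν r p.1 - posteriorMean (empiricalMeasure p.2) r p.1‖ :=
    ((hDm.comp measurable_fst).sub (measurable_posteriorMean_empiricalMeasure r)).norm
  have hint : Integrable (fun p : EuclideanSpace ℝ (Fin d) ×
      (Fin N → EuclideanSpace ℝ (Fin d)) =>
      ‖posteriorMean ν r p.1 - posteriorMean (empiricalMeasure p.2) r p.1‖)
      ((mixtureLaw ν r).prod (Measure.pi fun _ : Fin N => ν)) := by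
    refine Integrable.of_bound (C := K + K) hG.aestronglyMeasurable ?_
    filter_upwards [Measure.quasiMeasurePreserving_snd.ae (ae_pi_norm_le hν)] with p hp
    rw [norm_norm]
    exact hb _ _ hp
  -- Passing to the Gaussian reference measure produces the weight `mixtureDensity ν r x`, exactly
  -- the one in the pointwise estimate. Jensen then bounds the Gaussian mean of `√Q`.
  rw [integral_prod _ hint, integral_mixtureLaw_eq r
    (f := fun x => ∫ η, ‖posteriorMean ν r x - posteriorMean (empiricalMeasure η) r x‖
      ∂(Measure.pi fun _ : Fin N => ν)) (B := K + K)]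
  · obtain ⟨i1, h1⟩ := integral_integral_shiftDensity_sq_le hν r
    have hQ0 : ∀ x, 0 ≤ ∫ v, shiftDensity (r • v) x ^ 2 ∂ν :=
      fun x => integral_nonneg fun v => sq_nonneg _
    have hs := integrable_and_integral_le_of_sq_le (c := Real.exp (K ^ 2 * r ^ 2 / 2))
      (ν := stdGaussian (EuclideanSpace ℝ (Fin d)))
      (f := fun x => √(∫ v, shiftDensity (r • v) x ^ 2 ∂ν))
      i1.aestronglyMeasurable.aemeasurable.sqrt.aestronglyMeasurable
      (by simpa only [Real.sq_sqrt (hQ0 _)] using i1) (Real.exp_pos _).le (by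
        simp_rw [Real.sq_sqrt (hQ0 _)]
        refine h1.trans_eq ?_
        rw [← Real.exp_nat_mul]
        congr 1
        push_cast
        ring)
    calc _ ≤ ∫ x, 2 * K / √N * √(∫ v, shiftDensity (r • v) x ^ 2 ∂ν)
          ∂(stdGaussian (EuclideanSpace ℝ (Fin d))) := by
          refine integral_mono_of_nonneg (ae_of_all _ fun x => ?_) (hs.1.const_mul _)
            (ae_of_all _ fun x => ?_)
          · exact mul_nonneg (mixtureDensity_pos hν r x).le
              (integral_nonneg fun _ => norm_nonneg _)
          · simp_rw [norm_sub_rev (posteriorMean ν r x)]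
            exact mixtureDensity_mul_integral_norm_sub_le hN hν r x
      _ ≤ _ := by
          rw [integral_const_mul]
          have := hs.2
          gcongr
  · exact (StronglyMeasurable.integral_prod_right (f := fun x η =>
      ‖posteriorMean ν r x - posteriorMean (empiricalMeasure η) r x‖)
      hG.stronglyMeasurable).measurable
  · intro x
    have := norm_integral_le_of_norm_le_const (μ := Measure.pi fun _ : Fin N => ν)
      (f := fun η => ‖posteriorMean ν r x - posteriorMean (empiricalMeasure η) r x‖) (C := K + K)
      (by
        filter_upwards [ae_pi_norm_le hν] with η hη
        rw [norm_norm]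
        exact hb x η hη)
    simpa using this

end Empirical

end ProbFlow

namespace ProbFlow

/-! ### Law and measurability of the flow at a fixed time. -/

section FlowLaw

/-- The path `y` satisfies `y' = D(r, y)` on `[0, R]` up to errors that are quadratic in the length
of the time step. -/
def IsApproxPath {E : Type*} [NormedAddCommGroup E] [NormedSpace ℝ E] (D : ℝ → E → E) (R c : ℝ)
    (y : ℝ → E) : Prop :=
  ∀ s ∈ Set.Icc 0 R, ∀ s' ∈ Set.Icc s R, ‖y s' - y s - (s' - s) • D s (y s)‖ ≤ c * (s' - s) ^ 2

theorem IsApproxPath.mono {E : Type*} [NormedAddCommGroup E] [NormedSpace ℝ E] {D : ℝ → E → E}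
    {R R' c : ℝ} {y : ℝ → E} (hy : IsApproxPath D R c y) (hR : R' ≤ R) :
    IsApproxPath D R' c y := fun s hs s' hs' =>
  hy s ⟨hs.1, hs.2.trans hR⟩ s' ⟨hs'.1, hs'.2.trans hR⟩

theorem continuous_eulerFlow {E : Type*} [NormedAddCommGroup E] [NormedSpace ℝ E]
    {D : ℝ → E → E} (hD : ∀ r, 0 ≤ r → Continuous (D r)) {h : ℝ} (hh : 0 ≤ h) (m : ℕ) :
    ∀ k, Continuous (eulerFlow D h k m) := by
  induction m with
  | zero => exact fun k => continuous_id
  | succ m ih =>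
    intro k
    have := hD (k * h) (by positivity)
    exact (ih (k + 1)).comp (by fun_prop)

section PosteriorPath

variable {E : Type*} [NormedAddCommGroup E] [InnerProductSpace ℝ E] [FiniteDimensional ℝ E]
  [MeasurableSpace E] [BorelSpace E] {ν : Measure E} [IsProbabilityMeasure ν] {K R : ℝ}

theorem norm_posteriorMean_sub_le_of_mem_Icc (hν : ∀ᵐ v ∂ν, ‖v‖ ≤ K) :
    ∀ r ∈ Set.Icc 0 R, ∀ x y, ‖posteriorMean ν r x - posteriorMean ν r y‖ ≤ K ^ 2 * R * ‖x - y‖ :=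
  fun r hr x y => (norm_posteriorMean_sub_le hν hr.1 x y).trans (by gcongr; exact hr.2)

theorem IsApproxPath.tendsto_eulerFlow (hν : ∀ᵐ v ∂ν, ‖v‖ ≤ K) (hR : 0 ≤ R) {c : ℝ}
    (hc : 0 ≤ c) {y : ℝ → E} (hy : IsApproxPath (posteriorMean ν) R c y) :
    Tendsto (fun n : ℕ => eulerFlow (posteriorMean ν) (R / n) 0 n (y 0)) atTop (𝓝 (y R)) :=
  ProbFlow.tendsto_eulerFlow hR (by positivity) hc (norm_posteriorMean_sub_le_of_mem_Icc hν) hy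

variable {Ω β : Type*} [MeasurableSpace Ω] [MeasurableSpace β] {P : Measure Ω} {π : Measure β} [IsProbabilityMeasure π] {Y₀ : Ω → E} {η : Ω → β}
  {y : Ω → ℝ → E}

/-- The joint law of the value of the flow at time `R` and of data independent of its initial
value. -/
theorem map_flow_prod_eq (hν : ∀ᵐ v ∂ν, ‖v‖ ≤ K) (hR : 0 ≤ R) (hY₀ : AEMeasurable Y₀ P)
    (hη : AEMeasurable η P) (hlaw : P.map (fun ω => (Y₀ ω, η ω)) = (stdGaussian E).prod π)
    (hy : ∀ᵐ ω ∂P, y ω 0 = Y₀ ω ∧ ∃ c, 0 ≤ c ∧ IsApproxPath (posteriorMean ν) R c (y ω)) :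
    AEMeasurable (fun ω => y ω R) P ∧
      P.map (fun ω => (y ω R, η ω)) = (mixtureLaw ν R).prod π := by
  set Φ : ℕ → E → E := fun n => eulerFlow (posteriorMean ν) (R / n) 0 n with hΦ
  have hΦc : ∀ n, Continuous (Φ n) := fun n =>
    continuous_eulerFlow (fun r hr => continuous_posteriorMean hν hr) (by positivity) n 0
  have hlim : ∀ᵐ ω ∂P, Tendsto (fun n => Φ n (Y₀ ω)) atTop (𝓝 (y ω R)) := by
    filter_upwards [hy] with ω hω
    obtain ⟨h0, c, hc, hpath⟩ := hω
    rw [← h0]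
    exact hpath.tendsto_eulerFlow hν hR hc
  have hY₀law : P.map Y₀ = stdGaussian E := by
    have h1 := congrArg (Measure.map Prod.fst) hlaw
    rw [AEMeasurable.map_map_of_aemeasurable measurable_fst.aemeasurable (hY₀.prodMk hη),
      Measure.map_fst_prod, measure_univ, one_smul] at h1
    exact h1
  have hex : ∀ᵐ x ∂(stdGaussian E), ∃ l, Tendsto (fun n => Φ n x) atTop (𝓝 l) := by
    rw [← hY₀law, ae_map_iff hY₀ (measurableSet_exists_tendsto fun n => (hΦc n).measurable)]
    filter_upwards [hlim] with ω hω
    exact ⟨_, hω⟩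
  -- The limit of the Euler maps is a measurable map of the initial value alone, so the flow
  -- inherits both measurability and independence of the data from `Y₀`.
  obtain ⟨F, hFm, hF⟩ := measurable_limit_of_tendsto_metrizable_ae
    (fun n => (hΦc n).measurable.aemeasurable) hex
  have hyF : ∀ᵐ ω ∂P, y ω R = F (Y₀ ω) := by
    rw [← hY₀law] at hF
    filter_upwards [hlim, ae_of_ae_map hY₀ hF] with ω h1 h2
    exact tendsto_nhds_unique h1 h2
  have hFlaw : (stdGaussian E).map F = mixtureLaw ν R := by
    have : IsProbabilityMeasure ((stdGaussian E).map F) :=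
      Measure.isProbabilityMeasure_map hFm.aemeasurable
    let μ₁ : ProbabilityMeasure E := ⟨(stdGaussian E).map F, this⟩
    let μ₂ : ProbabilityMeasure E := ⟨mixtureLaw ν R, inferInstance⟩
    -- Equality of the two laws is obtained as weak convergence of a constant sequence: bounded
    -- Lipschitz test functions suffice, and weak limits are unique.
    have ht : Tendsto (fun _ : ℕ => μ₁) atTop (𝓝 μ₂) := by
      rw [tendsto_iff_forall_lipschitz_integral_tendsto]
      rintro f ⟨C, hC⟩ ⟨L, hL⟩
      have hfB : ∀ x, |f x| ≤ C + |f 0| := by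
        intro x
        have h1 := hC x 0
        rw [Real.dist_eq] at h1
        have h2 := abs_sub_abs_le_abs_sub (f x) (f 0)
        linarith
      have hfL : ∀ x y, |f x - f y| ≤ L * ‖x - y‖ := fun x y => by
        have := hL.dist_le_mul x y
        rwa [Real.dist_eq, dist_eq_norm] at this
      have h1 := tendsto_integral_eulerFlow hν hR L.2 hfL hfB
      have h2 : Tendsto (fun n => ∫ x, f (Φ n x) ∂(stdGaussian E)) atTop
          (𝓝 (∫ x, f (F x) ∂(stdGaussian E))) := by
        refine tendsto_integral_of_dominated_convergence (fun _ => C + |f 0|)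
          (fun n => (hL.continuous.comp (hΦc n)).measurable.aestronglyMeasurable)
          (integrable_const _) (fun n => ae_of_all _ fun x => hfB _) ?_
        filter_upwards [hF] with x hx
        exact (hL.continuous.tendsto _).comp hx
      have h3 : ∫ x, f x ∂(μ₁ : Measure E) = ∫ x, f x ∂(μ₂ : Measure E) := by
        refine Eq.trans ?_ (tendsto_nhds_unique h2 h1)
        exact integral_map hFm.aemeasurable hL.continuous.measurable.aestronglyMeasurable
      rw [h3]
      exact tendsto_const_nhds
    have := tendsto_nhds_unique tendsto_const_nhds ht
    exact congrArg Subtype.val this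
  refine ⟨(hFm.comp_aemeasurable hY₀).congr (hyF.mono fun ω h => h.symm), ?_⟩
  have e1 : P.map (fun ω => (y ω R, η ω))
      = (P.map (fun ω => (Y₀ ω, η ω))).map (Prod.map F id) := by
    rw [AEMeasurable.map_map_of_aemeasurable (hFm.prodMap measurable_id).aemeasurable
      (hY₀.prodMk hη)]
    refine Measure.map_congr ?_
    filter_upwards [hyF] with ω hω
    simp [hω]
  rw [e1, hlaw, ← Measure.map_prod_map _ _ hFm measurable_id, hFlaw, Measure.map_id]

end PosteriorPath

section EmpiricalPath

variable {d N : ℕ} {K R : ℝ} {Ω : Type*} [MeasurableSpace Ω] {P : Measure Ω}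
  {Y₀ : Ω → EuclideanSpace ℝ (Fin d)} {η : Ω → Fin N → EuclideanSpace ℝ (Fin d)}
  {z : Ω → ℝ → EuclideanSpace ℝ (Fin d)}

theorem measurable_eulerFlow_empiricalMeasure (h : ℝ) (m : ℕ) :
    ∀ k, Measurable fun p : EuclideanSpace ℝ (Fin d) × (Fin N → EuclideanSpace ℝ (Fin d)) =>
      eulerFlow (posteriorMean (empiricalMeasure p.2)) h k m p.1 := by
  induction m with
  | zero => exact fun k => measurable_fst
  | succ m ih =>
    intro k
    have := measurable_posteriorMean_empiricalMeasure (d := d) (N := N) (k * h)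
    exact (ih (k + 1)).comp
      ((measurable_fst.add (this.const_smul h)).prodMk measurable_snd)

theorem ae_norm_le_empiricalMeasure {η : Fin N → EuclideanSpace ℝ (Fin d)}
    (hη : ∀ j, ‖η j‖ ≤ K) : ∀ᵐ v ∂(empiricalMeasure η), ‖v‖ ≤ K :=
  ae_empiricalMeasure (measurableSet_le measurable_norm measurable_const) hη

/-- The paths are given only for almost every outcome, with no measurability in it; this is
recovered from the Euler iterates, which depend measurably on the initial value and the data. -/
theorem aemeasurable_empiricalPath (hN : 1 ≤ N) (hR : 0 ≤ R) (hY₀ : AEMeasurable Y₀ P)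
    (hη : AEMeasurable η P) (hηK : ∀ᵐ ω ∂P, ∀ j, ‖η ω j‖ ≤ K)
    (hz : ∀ᵐ ω ∂P, z ω 0 = Y₀ ω ∧
      ∃ c, 0 ≤ c ∧ IsApproxPath (posteriorMean (empiricalMeasure (η ω))) R c (z ω)) :
    AEMeasurable (fun ω => z ω R) P := by
  refine aemeasurable_of_tendsto_metrizable_ae atTop (f := fun (n : ℕ) ω =>
    eulerFlow (posteriorMean (empiricalMeasure (η ω))) (R / n) 0 n (Y₀ ω)) (fun n => ?_) ?_
  · have := (measurable_eulerFlow_empiricalMeasure (d := d) (N := N) (R / n) n 0).comp_aemeasurable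
      (hY₀.prodMk hη)
    simpa only [Function.comp_def] using this
  · filter_upwards [hz, hηK] with ω hω hK
    obtain ⟨h0, c, hc, hpath⟩ := hω
    have := isProbabilityMeasure_empiricalMeasure hN (η ω)
    have key := IsApproxPath.tendsto_eulerFlow (ae_norm_le_empiricalMeasure hK) hR hc hpath
    rw [h0] at key
    exact key

end EmpiricalPath

end FlowLaw

/-! ### Grönwall estimate for the expected distance of the two flows. -/

section Stability

/-- The source grows like the integrating factor `exp (K² s² / 2)`, so after dividing by that factor
the bound grows linearly in `s`. The discretization error `C h²` per step only replaces `a` by `a +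
C h`. -/
theorem le_of_discrete_gronwall {K a C R : ℝ} {n : ℕ} (hn : 0 < n) (ha : 0 ≤ a) (hC : 0 ≤ C)
    (hR : 0 ≤ R) {u : ℝ → ℝ} (hu0 : u 0 = 0)
    (hstep : ∀ s h, 0 ≤ s → 0 ≤ h → s + h ≤ R →
      u (s + h) ≤ (1 + h * (K ^ 2 * s)) * u s + h * (a * Real.exp (K ^ 2 * s ^ 2 / 2))
        + C * h ^ 2) :
    u R ≤ R * (a + C * (R / n)) * Real.exp (K ^ 2 * R ^ 2 / 2) := by
  set h := R / n with hh
  have hn' : (n : ℝ) ≠ 0 := by positivity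
  have hh0 : 0 ≤ h := by positivity
  have hnh : n * h = R := mul_div_cancel₀ R hn'
  have key : ∀ k : ℕ, k ≤ n →
      u (k * h) ≤ (k * h) * (a + C * h) * Real.exp (K ^ 2 * (k * h) ^ 2 / 2) := by
    intro k
    induction k with
    | zero => intro _; simp [hu0]
    | succ k ih =>
      intro hk
      have ihk := ih (by omega)
      set s := (k : ℝ) * h with hs
      have hs0 : 0 ≤ s := by positivity
      have e : ((k + 1 : ℕ) : ℝ) * h = s + h := by rw [hs]; push_cast; ring
      have hsR : s + h ≤ R := by
        rw [← e, ← hnh]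
        gcongr
      rw [e]
      refine (hstep s h hs0 hh0 hsR).trans ?_
      set X := Real.exp (K ^ 2 * s ^ 2 / 2) with hX
      set X' := Real.exp (K ^ 2 * (s + h) ^ 2 / 2) with hX'
      -- This holds because `h s ≤ ((s + h)² - s²) / 2`.
      have h1 : (1 + h * (K ^ 2 * s)) * X ≤ X' := by
        calc (1 + h * (K ^ 2 * s)) * X ≤ Real.exp (h * (K ^ 2 * s)) * X := by
              gcongr
              linarith [Real.add_one_le_exp (h * (K ^ 2 * s))]
          _ = Real.exp (h * (K ^ 2 * s) + K ^ 2 * s ^ 2 / 2) := by rw [← Real.exp_add]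
          _ ≤ X' := by
              rw [hX']
              gcongr
              nlinarith [mul_nonneg (sq_nonneg K) (sq_nonneg h)]
      have h2 : X ≤ X' := by
        refine le_trans ?_ h1
        have : 0 ≤ h * (K ^ 2 * s) * X := by positivity
        linarith
      have h3 : 1 ≤ X' := Real.one_le_exp (by positivity)
      have hA : 0 ≤ a + C * h := by positivity
      calc (1 + h * (K ^ 2 * s)) * u s + h * (a * X) + C * h ^ 2
          ≤ (1 + h * (K ^ 2 * s)) * (s * (a + C * h) * X) + h * (a * X') + C * h ^ 2 * X' := by
            have : C * h ^ 2 ≤ C * h ^ 2 * X' := le_mul_of_one_le_right (by positivity) h3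
            gcongr
        _ = s * (a + C * h) * ((1 + h * (K ^ 2 * s)) * X) + h * (a + C * h) * X' := by ring
        _ ≤ s * (a + C * h) * X' + h * (a + C * h) * X' := by gcongr
        _ = _ := by ring
  have := key n le_rfl
  rwa [hnh] at this

variable {d N : ℕ} {ν : Measure (EuclideanSpace ℝ (Fin d))} [IsProbabilityMeasure ν] {K R c : ℝ}
  {Ω : Type*} [MeasurableSpace Ω] {P : Measure Ω} [IsProbabilityMeasure P]
  {Y₀ : Ω → EuclideanSpace ℝ (Fin d)} {η : Ω → Fin N → EuclideanSpace ℝ (Fin d)}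
  {y z : Ω → ℝ → EuclideanSpace ℝ (Fin d)}

/-- The intermediate term is `D' s (y s)`: the drifts are compared along `y`, and the Lipschitz
bound is applied to `D'`. In the application `y` is the population flow, whose law is known and
which is independent of the data defining `D'`. -/
theorem norm_sub_path_step_le {E : Type*} [NormedAddCommGroup E] [NormedSpace ℝ E]
    {D D' : ℝ → E → E} {C L : ℝ} {y z : ℝ → E} (hy : IsApproxPath D R C y)
    (hz : IsApproxPath D' R C z) {s h : ℝ} (hs : 0 ≤ s) (hh : 0 ≤ h) (hsh : s + h ≤ R)
    (hD' : ∀ x x', ‖D' s x - D' s x'‖ ≤ L * ‖x - x'‖) :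
    ‖y (s + h) - z (s + h)‖
      ≤ (1 + h * L) * ‖y s - z s‖ + h * ‖D s (y s) - D' s (y s)‖ + 2 * C * h ^ 2 := by
  have h1 := hy s ⟨hs, by linarith⟩ (s + h) ⟨by linarith, hsh⟩
  have h2 := hz s ⟨hs, by linarith⟩ (s + h) ⟨by linarith, hsh⟩
  rw [add_sub_cancel_left] at h1 h2
  have e : y (s + h) - z (s + h) = (y s - z s) + h • (D s (y s) - D' s (y s))
      + h • (D' s (y s) - D' s (z s)) + ((y (s + h) - y s - h • D s (y s))
        - (z (s + h) - z s - h • D' s (z s))) := by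
    simp only [smul_sub]
    abel
  have h3 := hD' (y s) (z s)
  rw [e]
  calc _ ≤ ‖y s - z s‖ + ‖h • (D s (y s) - D' s (y s))‖ + ‖h • (D' s (y s) - D' s (z s))‖
        + (‖y (s + h) - y s - h • D s (y s)‖ + ‖z (s + h) - z s - h • D' s (z s)‖) := by
        refine (norm_add_le _ _).trans (add_le_add ?_ (norm_sub_le _ _))
        refine (norm_add_le _ _).trans (add_le_add ?_ le_rfl)
        exact norm_add_le _ _
    _ ≤ ‖y s - z s‖ + h * ‖D s (y s) - D' s (y s)‖ + h * (L * ‖y s - z s‖)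
        + (C * h ^ 2 + C * h ^ 2) := by
        rw [norm_smul, norm_smul, Real.norm_eq_abs, abs_of_nonneg hh]
        gcongr
    _ = _ := by ring

theorem integral_norm_flow_sub_le (hN : 1 ≤ N) (hν : ∀ᵐ v ∂ν, ‖v‖ ≤ K) (hR : 0 ≤ R)
    (hc : 0 ≤ c) (hY₀ : AEMeasurable Y₀ P) (hη : AEMeasurable η P)
    (hlaw : P.map (fun ω => (Y₀ ω, η ω))
      = (stdGaussian (EuclideanSpace ℝ (Fin d))).prod (Measure.pi fun _ : Fin N => ν))
    (hy : ∀ᵐ ω ∂P, y ω 0 = Y₀ ω ∧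
      IsApproxPath (posteriorMean ν) R (c * (1 + ‖Y₀ ω‖)) (y ω))
    (hz : ∀ᵐ ω ∂P, z ω 0 = Y₀ ω ∧
      IsApproxPath (posteriorMean (empiricalMeasure (η ω))) R (c * (1 + ‖Y₀ ω‖)) (z ω)) :
    Integrable (fun ω => y ω R - z ω R) P ∧
      ∫ ω, ‖y ω R - z ω R‖ ∂P ≤ R * (2 * K / √N) * Real.exp (K ^ 2 * R ^ 2 / 2) := by
  have hK := nonneg_of_ae_norm_le hν
  have hηlaw : P.map η = Measure.pi fun _ : Fin N => ν := by
    have h1 := congrArg (Measure.map Prod.snd) hlaw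
    rw [AEMeasurable.map_map_of_aemeasurable measurable_snd.aemeasurable (hY₀.prodMk hη),
      Measure.map_snd_prod, measure_univ, one_smul] at h1
    exact h1
  have hηK : ∀ᵐ ω ∂P, ∀ j, ‖η ω j‖ ≤ K := by
    refine ae_of_ae_map (p := fun η : Fin N → EuclideanSpace ℝ (Fin d) => ∀ j, ‖η j‖ ≤ K) hη ?_
    rw [hηlaw]
    exact ae_pi_norm_le hν
  have hY₀law : P.map Y₀ = stdGaussian (EuclideanSpace ℝ (Fin d)) := by
    have h1 := congrArg (Measure.map Prod.fst) hlaw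
    rw [AEMeasurable.map_map_of_aemeasurable measurable_fst.aemeasurable (hY₀.prodMk hη),
      Measure.map_fst_prod, measure_univ, one_smul] at h1
    exact h1
  have hY₀int : Integrable (fun ω => 1 + ‖Y₀ ω‖) P := by
    refine (integrable_const _).add ?_
    have h1 := integrable_norm_stdGaussian (E := EuclideanSpace ℝ (Fin d))
    rw [← hY₀law] at h1
    exact h1.comp_aemeasurable hY₀
  have hcY : ∀ ω, 0 ≤ c * (1 + ‖Y₀ ω‖) := fun ω => by positivity
  have hymeas : ∀ s ∈ Set.Icc 0 R, AEMeasurable (fun ω => y ω s) P ∧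
      P.map (fun ω => (y ω s, η ω)) = (mixtureLaw ν s).prod (Measure.pi fun _ : Fin N => ν) :=
    fun s hs => map_flow_prod_eq hν hs.1 hY₀ hη hlaw
      (hy.mono fun ω h => ⟨h.1, _, hcY ω, h.2.mono hs.2⟩)
  have hzmeas : ∀ s ∈ Set.Icc 0 R, AEMeasurable (fun ω => z ω s) P := fun s hs =>
    aemeasurable_empiricalPath hN hs.1 hY₀ hη hηK
      (hz.mono fun ω h => ⟨h.1, _, hcY ω, h.2.mono hs.2⟩)
  have herr : ∀ s ∈ Set.Icc 0 R,
      Integrable (fun ω => ‖posteriorMean ν s (y ω s)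
        - posteriorMean (empiricalMeasure (η ω)) s (y ω s)‖) P ∧
      ∫ ω, ‖posteriorMean ν s (y ω s) - posteriorMean (empiricalMeasure (η ω)) s (y ω s)‖ ∂P
        ≤ 2 * K / √N * Real.exp (K ^ 2 * s ^ 2 / 2) := by
    intro s hs
    obtain ⟨hm, hl⟩ := hymeas s hs
    have hG : Measurable fun p : EuclideanSpace ℝ (Fin d) × (Fin N → EuclideanSpace ℝ (Fin d)) =>
        ‖posteriorMean ν s p.1 - posteriorMean (empiricalMeasure p.2) s p.1‖ :=
      (((continuous_posteriorMean hν hs.1).measurable.comp measurable_fst).sub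
        (measurable_posteriorMean_empiricalMeasure s)).norm
    constructor
    · refine Integrable.of_bound (C := K + K)
        (hG.comp_aemeasurable (hm.prodMk hη)).aestronglyMeasurable ?_
      filter_upwards [hηK] with ω hω
      have := isProbabilityMeasure_empiricalMeasure hN (η ω)
      rw [norm_norm]
      exact (norm_sub_le _ _).trans (add_le_add (norm_posteriorMean_le hν _ _)
        (norm_posteriorMean_le (ae_norm_le_empiricalMeasure hω) _ _))
    · have h1 := integral_norm_posteriorMean_sub_le hN hν s
      rw [← hl, integral_map (hm.prodMk hη) hG.aestronglyMeasurable] at h1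
      exact h1
  -- A single step from time 0 suffices: the drifts there are bounded by `K`, and the quadratic
  -- error is integrable because `‖Y₀‖` is.
  have hint : ∀ s ∈ Set.Icc 0 R, Integrable (fun ω => y ω s - z ω s) P := by
    intro s hs
    refine ((integrable_const (s * (K + K))).add
      (hY₀int.const_mul (2 * c * s ^ 2))).mono'
      ((hymeas s hs).1.sub (hzmeas s hs)).aestronglyMeasurable ?_
    filter_upwards [hy, hz, hηK] with ω h1 h2 h3
    have := isProbabilityMeasure_empiricalMeasure hN (η ω)
    have h4 := h1.2 0 ⟨le_rfl, hR⟩ s hs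
    have h5 := h2.2 0 ⟨le_rfl, hR⟩ s hs
    rw [sub_zero] at h4 h5
    rw [h1.1] at h4
    rw [h2.1] at h5
    have h6 := norm_posteriorMean_le hν 0 (Y₀ ω)
    have h7 := norm_posteriorMean_le (ae_norm_le_empiricalMeasure h3) 0 (Y₀ ω)
    have e : y ω s - z ω s = s • (posteriorMean ν 0 (Y₀ ω)
        - posteriorMean (empiricalMeasure (η ω)) 0 (Y₀ ω))
        + ((y ω s - Y₀ ω - s • posteriorMean ν 0 (Y₀ ω))
          - (z ω s - Y₀ ω - s • posteriorMean (empiricalMeasure (η ω)) 0 (Y₀ ω))) := by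
      simp only [smul_sub]
      abel
    rw [e]
    refine (norm_add_le _ _).trans ?_
    simp only [Pi.add_apply]
    refine (add_le_add ?_ ((norm_sub_le _ _).trans (add_le_add h4 h5))).trans_eq
      (b := s * (K + K) + (c * (1 + ‖Y₀ ω‖) * s ^ 2 + c * (1 + ‖Y₀ ω‖) * s ^ 2)) (by ring)
    rw [norm_smul, Real.norm_eq_abs, abs_of_nonneg hs.1]
    have hs0 := hs.1
    gcongr
    exact (norm_sub_le _ _).trans (add_le_add h6 h7)
  refine ⟨hint R ⟨hR, le_rfl⟩, ?_⟩
  set C := 2 * c * ∫ ω, (1 + ‖Y₀ ω‖) ∂P with hC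
  have hC0 : 0 ≤ C := mul_nonneg (by positivity) (integral_nonneg fun ω => by positivity)
  have hstep : ∀ s h, 0 ≤ s → 0 ≤ h → s + h ≤ R →
      ∫ ω, ‖y ω (s + h) - z ω (s + h)‖ ∂P ≤ (1 + h * (K ^ 2 * s)) * ∫ ω, ‖y ω s - z ω s‖ ∂P
        + h * (2 * K / √N * Real.exp (K ^ 2 * s ^ 2 / 2)) + C * h ^ 2 := by
    intro s h hs hh hsh
    have hsI : s ∈ Set.Icc 0 R := ⟨hs, by linarith⟩
    obtain ⟨i2, h2⟩ := herr s hsI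
    have i1 := (hint s hsI).norm.const_mul (1 + h * (K ^ 2 * s))
    have i2' := i2.const_mul h
    have i3 := hY₀int.const_mul (2 * c * h ^ 2)
    calc _ ≤ ∫ ω, ((1 + h * (K ^ 2 * s)) * ‖y ω s - z ω s‖
          + h * ‖posteriorMean ν s (y ω s) - posteriorMean (empiricalMeasure (η ω)) s (y ω s)‖
          + 2 * c * h ^ 2 * (1 + ‖Y₀ ω‖)) ∂P := by
          refine integral_mono_of_nonneg (ae_of_all _ fun ω => norm_nonneg _)
            ((i1.add i2').add i3) ?_
          filter_upwards [hy, hz, hηK] with ω h1 h2 h3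
          have := isProbabilityMeasure_empiricalMeasure hN (η ω)
          refine (norm_sub_path_step_le h1.2 h2.2 hs hh hsh
            (norm_posteriorMean_sub_le (ae_norm_le_empiricalMeasure h3) hs)).trans_eq ?_
          ring
      _ = (1 + h * (K ^ 2 * s)) * ∫ ω, ‖y ω s - z ω s‖ ∂P
          + h * ∫ ω, ‖posteriorMean ν s (y ω s)
            - posteriorMean (empiricalMeasure (η ω)) s (y ω s)‖ ∂P + C * h ^ 2 := by
          rw [integral_add (f := fun ω => (1 + h * (K ^ 2 * s)) * ‖y ω s - z ω s‖
            + h * ‖posteriorMean ν s (y ω s) - posteriorMean (empiricalMeasure (η ω)) s (y ω s)‖)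
            (i1.add i2') i3, integral_add i1 i2', integral_const_mul, integral_const_mul,
            integral_const_mul, hC]
          ring
      _ ≤ _ := by gcongr
  have hu0 : ∫ ω, ‖y ω 0 - z ω 0‖ ∂P = 0 := by
    refine integral_eq_zero_of_ae ?_
    filter_upwards [hy, hz] with ω h1 h2
    simp [h1.1, h2.1]
  have hlim : Tendsto (fun n : ℕ => R * (2 * K / √N + C * (R / n)) * Real.exp (K ^ 2 * R ^ 2 / 2))
      atTop (𝓝 (R * (2 * K / √N + C * 0) * Real.exp (K ^ 2 * R ^ 2 / 2))) := by
    have := tendsto_const_div_atTop_nhds_zero_nat R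
    exact (((this.const_mul C).const_add _).const_mul R).mul_const _
  rw [mul_zero, add_zero] at hlim
  -- Letting the number of steps tend to infinity removes the discretization error.
  refine ge_of_tendsto hlim ?_
  filter_upwards [eventually_gt_atTop 0] with n hn
  exact le_of_discrete_gronwall (u := fun s => ∫ ω, ‖y ω s - z ω s‖ ∂P) hn (by positivity) hC0 hR
    hu0 hstep

end Stability

end ProbFlow

namespace ProbFlow

/-! ### The time change `r = β_t / σ_t`. -/

section Schedule

variable {T : EReal} {σ : ℝ → ℝ}

theorem mem_timeInterval_of_le {s t : ℝ} (hs : 0 ≤ s) (hst : s ≤ t) (ht : t ∈ timeInterval T) :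
    s ∈ timeInterval T :=
  ⟨hs, (EReal.coe_le_coe_iff.2 hst).trans_lt ht.2⟩

theorem exists_gt_mem_timeInterval {t : ℝ} (ht : t ∈ timeInterval T) :
    ∃ u, t < u ∧ u ∈ timeInterval T := by
  obtain ⟨u, h1, h2⟩ := EReal.lt_iff_exists_real_btwn.1 ht.2
  have h1' := EReal.coe_lt_coe_iff.1 h1
  exact ⟨u, h1', ht.1.trans h1'.le, h2⟩

theorem timeInterval_mem_nhdsGE {t : ℝ} (ht : t ∈ timeInterval T) : timeInterval T ∈ 𝓝[≥] t := by
  obtain ⟨u, h1, h2⟩ := exists_gt_mem_timeInterval ht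
  filter_upwards [Icc_mem_nhdsGE h1] with s hs
  exact mem_timeInterval_of_le (ht.1.trans hs.1) hs.2 h2

theorem HypH.zero_mem (hH : HypH T σ) : (0 : ℝ) ∈ timeInterval T :=
  ⟨le_rfl, by simpa using hH.terminal_pos⟩

theorem HypH.sigma_zero (hH : HypH T σ) : σ 0 = 1 := by
  have h1 : Tendsto σ (𝓝[>] 0) (𝓝 (σ 0)) :=
    (hH.differentiable.continuousOn 0 hH.zero_mem).mono_left
      ((nhdsWithin_mono _ Set.Ioi_subset_Ici_self).trans
        (nhdsWithin_le_of_mem (timeInterval_mem_nhdsGE hH.zero_mem)))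
  exact tendsto_nhds_unique h1 hH.tendsto_zero

/-- Choose `u > t` in the interval: `σ t > σ u`, and `σ u` is at least the terminal limit 0. -/
theorem HypH.sigma_pos (hH : HypH T σ) {t : ℝ} (ht : t ∈ timeInterval T) : 0 < σ t := by
  obtain ⟨u, htu, hu⟩ := exists_gt_mem_timeInterval ht
  have hlt := hH.strictAnti ht hu htu
  refine lt_of_le_of_lt ?_ hlt
  have hev : ∀ᶠ s in comap ((↑) : ℝ → EReal) (𝓝[<] T), σ s ≤ σ u := by
    have hmem : Set.Ioo (u : EReal) T ∈ 𝓝[<] T := Ioo_mem_nhdsLT hu.2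
    filter_upwards [preimage_mem_comap hmem] with s hs
    have hus : u < s := EReal.coe_lt_coe_iff.1 hs.1
    exact (hH.strictAnti hu ⟨hu.1.trans hus.le, hs.2⟩ hus).le
  -- Real numbers accumulate at `T` from below, also when `T = ∞`, so the terminal limit is not
  -- vacuous.
  have hne : (comap ((↑) : ℝ → EReal) (𝓝[<] T)).NeBot := by
    rw [comap_neBot_iff]
    intro S hS
    obtain ⟨l, hl, hlS⟩ := (mem_nhdsLT_iff_exists_Ioo_subset' hu.2).1 hS
    obtain ⟨a, h1, h2⟩ := EReal.lt_iff_exists_real_btwn.1 (Set.mem_Iio.1 hl)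
    exact ⟨a, hlS ⟨h1, h2⟩⟩
  exact le_of_tendsto hH.tendsto_terminal hev

theorem HypH.sigmaDeriv_nonpos (hH : HypH T σ) (t : ℝ) : sigmaDeriv T σ t ≤ 0 :=
  hH.strictAnti.antitoneOn.derivWithin_nonpos

theorem HypH.hasDerivWithinAt_sigma (hH : HypH T σ) {t : ℝ} (ht : t ∈ timeInterval T) :
    HasDerivWithinAt σ (sigmaDeriv T σ t) (timeInterval T) t :=
  (hH.differentiable t ht).hasDerivWithinAt

/-- The signal-to-noise ratio `β_t / σ_t`. -/
noncomputable def signalRatio (σ : ℝ → ℝ) (t : ℝ) : ℝ := beta σ t / σ t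

theorem HypH.hasDerivWithinAt_inv_sigma (hH : HypH T σ) {t : ℝ} (ht : t ∈ timeInterval T) :
    HasDerivWithinAt (fun t => (σ t)⁻¹) (-sigmaDeriv T σ t / σ t ^ 2) (timeInterval T) t :=
  (hH.hasDerivWithinAt_sigma ht).fun_inv (hH.sigma_pos ht).ne'

theorem HypH.signalRatio_eq (hH : HypH T σ) {t : ℝ} (ht : t ∈ timeInterval T) :
    signalRatio σ t = (σ t)⁻¹ - 1 := by
  rw [signalRatio, beta, sub_div, div_self (hH.sigma_pos ht).ne', one_div]

theorem HypH.hasDerivWithinAt_signalRatio (hH : HypH T σ) {t : ℝ} (ht : t ∈ timeInterval T) :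
    HasDerivWithinAt (signalRatio σ) (-sigmaDeriv T σ t / σ t ^ 2) (timeInterval T) t :=
  ((hH.hasDerivWithinAt_inv_sigma ht).sub_const 1).congr (fun _ hs => hH.signalRatio_eq hs)
    (hH.signalRatio_eq ht)

theorem HypH.strictMonoOn_signalRatio (hH : HypH T σ) :
    StrictMonoOn (signalRatio σ) (timeInterval T) := by
  intro s hs t ht hst
  rw [hH.signalRatio_eq hs, hH.signalRatio_eq ht]
  have := (inv_lt_inv₀ (hH.sigma_pos hs) (hH.sigma_pos ht)).2 (hH.strictAnti hs ht hst)
  linarith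

theorem HypH.signalRatio_zero (hH : HypH T σ) : signalRatio σ 0 = 0 := by
  simp [signalRatio, beta, hH.sigma_zero]

/-- A mean value inequality with `signalRatio σ` as the clock, stated in the original time. The
inverse time change never has to be differentiated, which matters because `σ'` may vanish at some
times. -/
theorem HypH.norm_sub_le_signalRatio {E : Type*} [NormedAddCommGroup E] [NormedSpace ℝ E]
    (hH : HypH T σ) {f v : ℝ → E} {a b C : ℝ} (ha : a ∈ timeInterval T) (hb : b ∈ timeInterval T)
    (hab : a ≤ b)
    (hf : ∀ t ∈ Set.Icc a b, HasDerivWithinAt f ((-sigmaDeriv T σ t / σ t ^ 2) • v t)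
      (timeInterval T) t)
    (hv : ∀ t ∈ Set.Icc a b, ‖v t‖ ≤ C) :
    ‖f b - f a‖ ≤ C * (signalRatio σ b - signalRatio σ a) := by
  have hsub : Set.Icc a b ⊆ timeInterval T := fun t ht =>
    mem_timeInterval_of_le (ha.1.trans ht.1) ht.2 hb
  have hIci : ∀ t ∈ Set.Ico a b, timeInterval T ∈ 𝓝[≥] t := fun t ht =>
    timeInterval_mem_nhdsGE (hsub (Set.Ico_subset_Icc_self ht))
  refine image_norm_le_of_norm_deriv_right_le_deriv_boundary' (f := fun t => f t - f a)
    (f' := fun t => (-sigmaDeriv T σ t / σ t ^ 2) • v t)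
    (B := fun t => C * (signalRatio σ t - signalRatio σ a))
    (B' := fun t => C * (-sigmaDeriv T σ t / σ t ^ 2)) ?_ ?_ (by simp) ?_ ?_ ?_
    (Set.right_mem_Icc.2 hab)
  · exact fun t ht => ((hf t ht).continuousWithinAt.mono hsub).sub continuousWithinAt_const
  · exact fun t ht => ((hf t (Set.Ico_subset_Icc_self ht)).sub_const _).mono_of_mem_nhdsWithin
      (hIci t ht)
  · exact fun t ht => (((hH.hasDerivWithinAt_signalRatio (hsub ht)).sub_const _).const_mul
      C).continuousWithinAt.mono hsub
  · exact fun t ht => (((hH.hasDerivWithinAt_signalRatio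
      (hsub (Set.Ico_subset_Icc_self ht))).sub_const _).const_mul C).mono_of_mem_nhdsWithin
      (hIci t ht)
  · intro t ht
    have h1 := hH.sigmaDeriv_nonpos t
    have h2 : 0 ≤ -sigmaDeriv T σ t / σ t ^ 2 := div_nonneg (by linarith) (sq_nonneg _)
    rw [norm_smul, Real.norm_eq_abs, abs_of_nonneg h2, mul_comm]
    gcongr
    exact hv t (Set.Ico_subset_Icc_self ht)

/-- A time change: on `[0, t]` the ratio `β / σ` has a right inverse. -/
theorem HypH.exists_signalRatio_inverse (hH : HypH T σ) {t : ℝ} (ht : t ∈ timeInterval T) :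
    ∃ τ : ℝ → ℝ, τ (signalRatio σ t) = t ∧ τ 0 = 0 ∧
      ∀ ρ ∈ Set.Icc 0 (signalRatio σ t), τ ρ ∈ Set.Icc 0 t ∧ signalRatio σ (τ ρ) = ρ := by
  have hsub : Set.Icc 0 t ⊆ timeInterval T := fun s hs => mem_timeInterval_of_le hs.1 hs.2 ht
  have hcont : ContinuousOn (signalRatio σ) (Set.Icc 0 t) := fun s hs =>
    (hH.hasDerivWithinAt_signalRatio (hsub hs)).continuousWithinAt.mono hsub
  have hivt := intermediate_value_Icc ht.1 hcont
  rw [hH.signalRatio_zero] at hivt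
  have hex : ∀ ρ, ∃ s, ρ ∈ Set.Icc 0 (signalRatio σ t) → s ∈ Set.Icc 0 t ∧ signalRatio σ s = ρ := by
    intro ρ
    by_cases hρ : ρ ∈ Set.Icc 0 (signalRatio σ t)
    · obtain ⟨s, hs, h⟩ := hivt hρ
      exact ⟨s, fun _ => ⟨hs, h⟩⟩
    · exact ⟨0, fun h => absurd h hρ⟩
  choose τ hτ using hex
  have hR : 0 ≤ signalRatio σ t := by
    rw [← hH.signalRatio_zero]
    exact hH.strictMonoOn_signalRatio.monotoneOn hH.zero_mem ht ht.1
  refine ⟨τ, ?_, ?_, hτ⟩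
  · obtain ⟨h1, h2⟩ := hτ _ ⟨hR, le_rfl⟩
    exact hH.strictMonoOn_signalRatio.injOn (hsub h1) ht h2
  · obtain ⟨h1, h2⟩ := hτ 0 ⟨le_rfl, hR⟩
    exact hH.strictMonoOn_signalRatio.injOn (hsub h1) hH.zero_mem (h2.trans hH.signalRatio_zero.symm)

end Schedule

/-! ### Solutions of the original equation as approximate paths of the rescaled one. -/

section FlowSolution

variable {d : ℕ} {T : EReal} {σ : ℝ → ℝ} {ν : Measure (EuclideanSpace ℝ (Fin d))}
  [IsProbabilityMeasure ν] {K : ℝ}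

/-- Completing the square isolates a prefactor free of `v`, which cancels in the quotient defining
the denoiser. -/
theorem rho_sub_smul_eq {s b : ℝ} (hs : 0 < s) (x v : EuclideanSpace ℝ (Fin d)) :
    rho s (x - b • v) = ((2 * Real.pi * s ^ 2) ^ (-(d : ℝ) / 2)
      * Real.exp (-‖x‖ ^ 2 / (2 * s ^ 2))) * shiftDensity ((b / s) • v) (s⁻¹ • x) := by
  rw [rho, shiftDensity]
  conv_rhs => rw [mul_assoc, ← Real.exp_add]
  congr 2
  rw [norm_sub_sq_real, real_inner_smul_right, real_inner_smul_right, real_inner_smul_left,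
    norm_smul, norm_smul, mul_pow, mul_pow, Real.norm_eq_abs, Real.norm_eq_abs, sq_abs, sq_abs]
  field_simp
  ring

omit [IsProbabilityMeasure ν] in
theorem denoiser_eq_posteriorMean {t : ℝ} (ht : 0 < σ t) (x : EuclideanSpace ℝ (Fin d)) :
    denoiser σ ν t x = posteriorMean ν (signalRatio σ t) ((σ t)⁻¹ • x) := by
  have hc : (2 * Real.pi * σ t ^ 2) ^ (-(d : ℝ) / 2) * Real.exp (-‖x‖ ^ 2 / (2 * σ t ^ 2)) ≠ 0 := by
    positivity
  simp_rw [denoiser, rho_sub_smul_eq ht, mul_smul]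
  rw [integral_const_mul, integral_smul, integral_smul, ← mul_smul, smul_smul, posteriorMean_eq]
  congr 1
  rw [mixtureDensity, signalRatio]
  field_simp

-- The derivative of `1 / σ` contributes `-(σ' / σ²) y`, which cancels the linear part of the drift.
-- What is left is the derivative of the new clock times the posterior mean.
omit [IsProbabilityMeasure ν] in
theorem IsFlowSolution.hasDerivWithinAt_rescaled (hH : HypH T σ)
    {x₀ : EuclideanSpace ℝ (Fin d)} {y : ℝ → EuclideanSpace ℝ (Fin d)}
    (hy : IsFlowSolution T σ ν x₀ y) {t : ℝ} (ht : t ∈ timeInterval T) :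
    HasDerivWithinAt (fun t => (σ t)⁻¹ • y t) ((-sigmaDeriv T σ t / σ t ^ 2) •
      posteriorMean ν (signalRatio σ t) ((σ t)⁻¹ • y t)) (timeInterval T) t := by
  have hσ := hH.sigma_pos ht
  refine ((hH.hasDerivWithinAt_inv_sigma ht).fun_smul (hy.2 t ht)).congr_deriv ?_
  rw [drift, denoiser_eq_posteriorMean hσ, smul_smul, smul_sub]
  have e : (σ t)⁻¹ * (sigmaDeriv T σ t / σ t) = -(-sigmaDeriv T σ t / σ t ^ 2) := by
    field_simp
  rw [e, neg_smul, neg_smul]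
  abel

/-- The rescaled path has speed at most `K` in the new clock. With the Lipschitz bounds of the
posterior mean in space and time, the drift therefore varies by `O(s' - s)` over `[s, s']`, and
integration gives a quadratic error. The constant combines `K² R · K` from space with `K² (‖x₀‖ + 2
K R)` from time. -/
theorem IsFlowSolution.isApproxPath (hH : HypH T σ) (hν : ∀ᵐ v ∂ν, ‖v‖ ≤ K)
    {x₀ : EuclideanSpace ℝ (Fin d)} {y : ℝ → EuclideanSpace ℝ (Fin d)}
    (hy : IsFlowSolution T σ ν x₀ y) {t : ℝ} (ht : t ∈ timeInterval T) {τ : ℝ → ℝ}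
    (hτ : ∀ ρ ∈ Set.Icc 0 (signalRatio σ t), τ ρ ∈ Set.Icc 0 t ∧ signalRatio σ (τ ρ) = ρ) :
    IsApproxPath (posteriorMean ν) (signalRatio σ t)
      ((3 * K ^ 3 * signalRatio σ t + K ^ 2) * (1 + ‖x₀‖))
      (fun ρ => (σ (τ ρ))⁻¹ • y (τ ρ)) := by
  have hK := nonneg_of_ae_norm_le hν
  set R := signalRatio σ t
  set w : ℝ → EuclideanSpace ℝ (Fin d) := fun s => (σ s)⁻¹ • y s with hw
  have hderiv := fun s (hs : s ∈ timeInterval T) => hy.hasDerivWithinAt_rescaled hH hs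
  have hmono := hH.strictMonoOn_signalRatio
  have hsub : Set.Icc 0 t ⊆ timeInterval T := fun s hs => mem_timeInterval_of_le hs.1 hs.2 ht
  have hinc : ∀ a b, 0 ≤ a → a ≤ b → b ≤ t →
      ‖w b - w a‖ ≤ K * (signalRatio σ b - signalRatio σ a) := fun a b ha hab hb =>
    hH.norm_sub_le_signalRatio (hsub ⟨ha, hab.trans hb⟩) (hsub ⟨ha.trans hab, hb⟩) hab
      (fun s hs => hderiv s (hsub ⟨ha.trans hs.1, hs.2.trans hb⟩))
      (fun s _ => norm_posteriorMean_le hν _ _)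
  have hw0 : w 0 = x₀ := by simp [hw, hH.sigma_zero, hy.1]
  intro s hs s' hs'
  obtain ⟨ha, hra⟩ := hτ s hs
  obtain ⟨hb, hrb⟩ := hτ s' ⟨hs.1.trans hs'.1, hs'.2⟩
  set a := τ s
  set b := τ s'
  have hab : a ≤ b := by
    rw [← hmono.le_iff_le (hsub ha) (hsub hb), hra, hrb]
    exact hs'.1
  have hR0 : 0 ≤ R := hs.1.trans hs.2
  have hwa : ‖w a‖ ≤ ‖x₀‖ + K * R := by
    have h1 := hinc 0 a le_rfl ha.1 ha.2
    rw [hw0, hH.signalRatio_zero, sub_zero, hra] at h1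
    have h2 : K * s ≤ K * R := by gcongr; exact hs.2
    have h3 := norm_sub_norm_le (w a) x₀
    linarith
  -- Subtracting the motion with the drift frozen at time `s` leaves the difference of drifts as the
  -- derivative.
  have hf : ∀ u ∈ Set.Icc a b, HasDerivWithinAt
      (fun u => w u - signalRatio σ u • posteriorMean ν s (w a))
      ((-sigmaDeriv T σ u / σ u ^ 2) •
        (posteriorMean ν (signalRatio σ u) (w u) - posteriorMean ν s (w a)))
      (timeInterval T) u := by
    intro u hu
    have huI := hsub ⟨ha.1.trans hu.1, hu.2.trans hb.2⟩
    rw [smul_sub]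
    exact (hderiv u huI).fun_sub ((hH.hasDerivWithinAt_signalRatio huI).smul_const _)
  have hv : ∀ u ∈ Set.Icc a b,
      ‖posteriorMean ν (signalRatio σ u) (w u) - posteriorMean ν s (w a)‖
        ≤ (3 * K ^ 3 * R + K ^ 2) * (1 + ‖x₀‖) * (s' - s) := by
    intro u hu
    have huI := hsub ⟨ha.1.trans hu.1, hu.2.trans hb.2⟩
    have h1 : s ≤ signalRatio σ u := by
      rw [← hra]
      exact hmono.monotoneOn (hsub ha) huI hu.1
    have h2 : signalRatio σ u ≤ s' := by
      rw [← hrb]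
      exact hmono.monotoneOn huI (hsub hb) hu.2
    set ρ := signalRatio σ u
    have hρ : ρ ∈ Set.Icc 0 R := ⟨hs.1.trans h1, h2.trans hs'.2⟩
    have h3 := hinc a u ha.1 hu.1 (hu.2.trans hb.2)
    rw [hra] at h3
    have h4 : ‖posteriorMean ν ρ (w u) - posteriorMean ν ρ (w a)‖
        ≤ K ^ 2 * R * (K * (s' - s)) := by
      refine (norm_posteriorMean_sub_le_of_mem_Icc hν ρ hρ _ _).trans ?_
      gcongr
      exact h3.trans (by gcongr)
    have h5 : ‖posteriorMean ν ρ (w a) - posteriorMean ν s (w a)‖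
        ≤ K ^ 2 * ((‖x₀‖ + K * R) + R * K) * (s' - s) := by
      refine (norm_posteriorMean_time_sub_le hν hρ hs _).trans ?_
      rw [abs_of_nonneg (by linarith)]
      gcongr
    have h6 : 0 ≤ s' - s := by linarith [hs'.1]
    calc _ ≤ K ^ 2 * R * (K * (s' - s)) + K ^ 2 * ((‖x₀‖ + K * R) + R * K) * (s' - s) := by
          rw [← sub_add_sub_cancel _ (posteriorMean ν ρ (w a)) _]
          exact (norm_add_le _ _).trans (add_le_add h4 h5)
      _ = (3 * K ^ 3 * R + K ^ 2 * ‖x₀‖) * (s' - s) := by ring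
      _ ≤ _ := by
          gcongr
          have : 0 ≤ 3 * K ^ 3 * R * ‖x₀‖ := by positivity
          have : 0 ≤ K ^ 2 := sq_nonneg K
          linarith
  have := hH.norm_sub_le_signalRatio (hsub ha) (hsub hb) hab hf hv
  rw [hra, hrb] at this
  have e : w b - w a - (s' - s) • posteriorMean ν s (w a)
      = w b - s' • posteriorMean ν s (w a) - (w a - s • posteriorMean ν s (w a)) := by
    rw [sub_smul]
    abel
  calc _ = ‖w b - s' • posteriorMean ν s (w a) - (w a - s • posteriorMean ν s (w a))‖ := by
        rw [← e]
    _ ≤ _ := this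
    _ = _ := by ring

end FlowSolution

/-! ### Undoing the rescaling for a fixed sample size. -/

section Comparison

variable {d N : ℕ} {T : EReal} {σ : ℝ → ℝ} {μ₀ : Measure (EuclideanSpace ℝ (Fin d))}
  [IsProbabilityMeasure μ₀] {K : ℝ} {Ω : Type*} [MeasurableSpace Ω] {P : Measure Ω}
  [IsProbabilityMeasure P] {Y₀ : Ω → EuclideanSpace ℝ (Fin d)}
  {η : Fin N → Ω → EuclideanSpace ℝ (Fin d)} {Y Z : ℝ → Ω → EuclideanSpace ℝ (Fin d)}

theorem HypH.integral_norm_flowSolution_sub_le (hH : HypH T σ) (hμ₀ : ∀ᵐ v ∂μ₀, ‖v‖ ≤ K)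
    (hN : 1 ≤ N) (hY₀ : HasLaw Y₀ (stdGaussian (EuclideanSpace ℝ (Fin d))) P)
    (hη : ∀ j, HasLaw (η j) μ₀ P) (hηi : iIndepFun η P) (hηY₀ : IndepFun Y₀ (fun ω j => η j ω) P)
    (hY : ∀ᵐ ω ∂P, IsFlowSolution T σ μ₀ (Y₀ ω) (fun t => Y t ω))
    (hZ : ∀ᵐ ω ∂P, IsFlowSolution T σ (empiricalMeasure (fun j => η j ω)) (Y₀ ω)
      (fun t => Z t ω)) {t : ℝ} (ht : t ∈ timeInterval T) :
    Integrable (fun ω => Y t ω - Z t ω) P ∧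
      √N * ∫ ω, ‖Y t ω - Z t ω‖ ∂P
        ≤ 2 * K * beta σ t * Real.exp (K ^ 2 * beta σ t ^ 2 / (2 * σ t ^ 2)) := by
  have hK := nonneg_of_ae_norm_le hμ₀
  have hσ := hH.sigma_pos ht
  have hηm : AEMeasurable (fun ω j => η j ω) P :=
    aemeasurable_pi_lambda _ fun j => (hη j).aemeasurable
  have hηlaw : P.map (fun ω j => η j ω) = Measure.pi fun _ => μ₀ := by
    rw [(iIndepFun_iff_map_fun_eq_pi_map fun j => (hη j).aemeasurable).1 hηi]
    simp_rw [(hη _).map_eq]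
  have hlaw : P.map (fun ω => (Y₀ ω, fun j => η j ω))
      = (stdGaussian (EuclideanSpace ℝ (Fin d))).prod (Measure.pi fun _ : Fin N => μ₀) := by
    rw [(indepFun_iff_map_prod_eq_prod_map_map hY₀.aemeasurable hηm).1 hηY₀, hY₀.map_eq, hηlaw]
  have hηK : ∀ᵐ ω ∂P, ∀ j, ‖η j ω‖ ≤ K := by
    rw [ae_all_iff]
    intro j
    have h1 := hμ₀
    rw [← (hη j).map_eq] at h1
    exact ae_of_ae_map (hη j).aemeasurable h1
  obtain ⟨τ, hτt, hτ0, hτ⟩ := hH.exists_signalRatio_inverse ht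
  set R := signalRatio σ t with hRdef
  have hR : 0 ≤ R := by
    rw [← hH.signalRatio_zero]
    exact hH.strictMonoOn_signalRatio.monotoneOn hH.zero_mem ht ht.1
  have key := integral_norm_flow_sub_le (c := 3 * K ^ 3 * R + K ^ 2) (R := R) hN hμ₀ hR
    (by positivity) hY₀.aemeasurable hηm hlaw
    (y := fun ω ρ => (σ (τ ρ))⁻¹ • Y (τ ρ) ω) (z := fun ω ρ => (σ (τ ρ))⁻¹ • Z (τ ρ) ω)
    (by
      filter_upwards [hY] with ω h
      refine ⟨?_, h.isApproxPath hH hμ₀ ht hτ⟩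
      rw [hτ0, hH.sigma_zero, inv_one, one_smul]
      exact h.1)
    (by
      filter_upwards [hZ, hηK] with ω h hω
      have := isProbabilityMeasure_empiricalMeasure hN (fun j => η j ω)
      refine ⟨?_, h.isApproxPath hH (ae_norm_le_empiricalMeasure hω) ht hτ⟩
      rw [hτ0, hH.sigma_zero, inv_one, one_smul]
      exact h.1)
  simp only [hτt, ← smul_sub] at key
  obtain ⟨h1, h2⟩ := key
  simp_rw [norm_smul, norm_inv, Real.norm_eq_abs, abs_of_pos hσ] at h2
  rw [integral_const_mul, inv_mul_le_iff₀ hσ] at h2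
  refine ⟨(integrable_smul_iff (inv_ne_zero hσ.ne') _).1 h1, ?_⟩
  -- The factor `√N` cancels the sampling rate, and `σ_t R = β_t`.
  have hN' : √(N : ℝ) ≠ 0 := by positivity
  calc √N * ∫ ω, ‖Y t ω - Z t ω‖ ∂P
      ≤ √N * (σ t * (R * (2 * K / √N) * Real.exp (K ^ 2 * R ^ 2 / 2))) := by gcongr
    _ = 2 * K * (σ t * R) * Real.exp (K ^ 2 * R ^ 2 / 2) := by field_simp
    _ = _ := by
        rw [hRdef, signalRatio, mul_div_cancel₀ _ hσ.ne']
        congr 2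
        field_simp

end Comparison

end ProbFlow

/-! ### The main theorem, uniformly in the sample size. -/

theorem theorem3p2 {d : ℕ} {T : EReal} {σ : ℝ → ℝ} (hH : ProbFlow.HypH T σ)
    (μ₀ : Measure (EuclideanSpace ℝ (Fin d))) [IsProbabilityMeasure μ₀]
    {K : ℝ} (hK : μ₀.support ⊆ Metric.closedBall 0 K)
    {Ω : Type*} [MeasurableSpace Ω] (P : Measure Ω) [IsProbabilityMeasure P]
    -- the Gaussian initial value
    (Y₀ : Ω → EuclideanSpace ℝ (Fin d))
    (hY₀ : HasLaw Y₀ (stdGaussian (EuclideanSpace ℝ (Fin d))) P)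
    -- for each sample size `N ≥ 1`, an i.i.d. data set with law `μ₀`, independent of `Y₀`
    (η : (N : ℕ) → Fin N → Ω → EuclideanSpace ℝ (Fin d))
    (hη_law : ∀ N, 1 ≤ N → ∀ j, HasLaw (η N j) μ₀ P)
    (hη_indep : ∀ N, 1 ≤ N → iIndepFun (η N) P)
    (hη_Y₀ : ∀ N, 1 ≤ N → IndepFun Y₀ (fun ω j => η N j ω) P)
    -- the solution of the ODE driven by `μ₀`
    (Y : ℝ → Ω → EuclideanSpace ℝ (Fin d))
    (hY : ∀ᵐ ω ∂P, ProbFlow.IsFlowSolution T σ μ₀ (Y₀ ω) (fun t => Y t ω))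
    -- the solutions of the ODEs driven by the empirical measures
    (YN : ℕ → ℝ → Ω → EuclideanSpace ℝ (Fin d))
    (hYN : ∀ N, 1 ≤ N → ∀ᵐ ω ∂P, ProbFlow.IsFlowSolution T σ
      (ProbFlow.empiricalMeasure (fun j => η N j ω)) (Y₀ ω) (fun t => YN N t ω)) :
    ∀ t ∈ ProbFlow.timeInterval T,
      (∀ N, 1 ≤ N → Integrable (fun ω => Y t ω - YN N t ω) P) ∧
      ⨆ (N : ℕ) (_ : 1 ≤ N),
          ENNReal.ofReal (Real.sqrt N) * ∫⁻ ω, ‖Y t ω - YN N t ω‖ₑ ∂P ≤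
        ENNReal.ofReal (2 * K * ProbFlow.beta σ t *
          Real.exp (K ^ 2 * ProbFlow.beta σ t ^ 2 / (2 * σ t ^ 2))) := by
  -- The complement of the support is a null set, so the support condition becomes an almost sure
  -- bound.
  have hμ₀ : ∀ᵐ v ∂μ₀, ‖v‖ ≤ K := by
    filter_upwards [Measure.support_mem_ae (μ := μ₀)] with v hv
    simpa using hK hv
  intro t ht
  have key := fun N (hN : 1 ≤ N) => hH.integral_norm_flowSolution_sub_le hμ₀ hN hY₀ (hη_law N hN)
    (hη_indep N hN) (hη_Y₀ N hN) hY (hYN N hN) ht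
  refine ⟨fun N hN => (key N hN).1, iSup₂_le fun N hN => ?_⟩
  obtain ⟨h1, h2⟩ := key N hN
  rw [← ofReal_integral_norm_eq_lintegral_enorm h1, ← ENNReal.ofReal_mul (Real.sqrt_nonneg _)]
  exact ENNReal.ofReal_le_ofReal h2
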